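/- Let $F$ be any subfield of $\mathbb R$. **Theories.** For $a\in F$ let $f_a$ be a unary function symbol, interpreted in $\mathbb R$ as $x\mapsto ax$. Let $T_{\rm add}[F]$ be the complete first-order theory of $\mathbb R$ in the language $0,1,+,-,<,(f_a)_{a\in F}$, let $T_{\rm mult}[F]$ be the complete theory of $\mathbb R$ in the language $0,1,\times,\div,<,(f_a)_{a\in F}$ (with $x\div 0=0$), and let $T[F]=T_{\rm add}[F]\cup T_{\rm mult}[F]$. Let $T[F]^*$ be the theory in the language $0,1,+,\times,<$ with constants $c_a$ ($a\in F$) whose axioms say: (1) $0,+,<$ is an ordered abelian group; (2) $\times$ is associative and commutative, and $1,\times,<$ is a divisible ordered abelian group on the positive elements; (3) $c_{a+b}=c_a+c_b$ and $c_{ab}=c_a\times c_b$ for $a,b\in F$, and $0<c_a$ for $0<a\in F$; (4) $c_{a+b}\times x=(c_a\times x)+(c_b\times x)$ and $c_a\times(x+y)=(c_a\times x)+(c_a\times y)$ for $a,b\in F$. **Problems.** An existential sentence is a sentence $\exists x_1\cdots\exists x_n\,\varphi$ with $\varphi$ quantifier-free. It is written as a string over a finite alphabet: first the quantifier prefix,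 with the variables named by strings of binary digits, then $\varphi$ in prefix notation. Consider these decision problems. * The existential theory of $F$: given an existential sentence in $0,1,+,-,\times,<$, is it true in the ordered field $F$? * The existential consequences of $T[F]$ without auxiliary functions: given an existential sentence in $0,1,+,-,\times,\div,<$ (no symbols $f_a$), is it a consequence of $T[F]$? * The existential consequences of $T[F]^*$ without auxiliary constants: given an existential sentence in $0,1,+,\times,<$ (no symbols $c_a$), is it a consequence of $T[F]^*$? * Hilbert's 10th problem over $\mathbb Q$: given an equation $p=0$, written as $\exists x_1\cdots\exists x_n\; p=0$, where $p\in\mathbb Z[x_1,\dots,x_n]$ is given by an expression in $0,1,+,-,\times,x_1,\dots,x_n$, does it have a solution in $\mathbb Q^n$? A problem $P$ is linear-time reducible to a problem $Q$ if there is a function $f$ from instances of $P$ to instances of $Q$ such that $a$ is a yes-instance of $P$ if and only if $f(a)$ is a yes-instance of $Q$, and such that some Turing machine with finitely many stacks computes the string of $f(a)$ from the string of $a$ in a number of steps that is at most linear in the length of the string of $a$. **Theorem.** 1. For every subfield $F$ of $\mathbb R$, the existential theory of $F$ is linear-time reducible to the existential consequences of $T[F]$ without auxiliary functions, and also to the existential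 consequences of $T[F]^*$ without auxiliary constants. 2. If Hilbert's 10th problem over $\mathbb Q$ is undecidable, then the existential consequences of $T[\mathbb Q]$ without auxiliary functions are undecidable, and so are the existential consequences of $T[\mathbb Q]^*$ without auxiliary constants. 3. Hilbert's 10th problem over $\mathbb Q$ is linear-time reducible to the existential consequences of $T[\mathbb Q]$ without auxiliary functions, and to the existential consequences of $T[\mathbb Q]^*$ without auxiliary constants. -/

import Mathlib

namespace RealFragments

open FirstOrder FirstOrder.Language

/-! ### Languages -/

/-- The binary operation symbols. -/
inductive Op
  | add | sub | mul | div
  deriving DecidableEq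

instance : Fintype Op := ⟨{.add, .sub, .mul, .div}, fun x => by cases x <;> decide⟩

/-- The function symbols over a set `S` of binary operation symbols, with constant symbols `c`
for `c : C` and unary function symbols `f_a` for `a : A`; `0` and `1` are always present. -/
inductive Func (S : Set Op) (C A : Type) : ℕ → Type
  | zero : Func S C A 0
  | one : Func S C A 0
  | cst (c : C) : Func S C A 0
  | aux (a : A) : Func S C A 1
  | op (o : S) : Func S C A 2

/-- The only relation symbol besides equality is `<`. -/
inductive Rel : ℕ → Type
  | lt : Rel 2

/-- The language `0, 1, <`, the operations in `S`, constants `C`, unary functions `A`. -/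
def Lang (S : Set Op) (C A : Type) : Language := ⟨Func S C A, Rel⟩

/-- Enlarging the set of operation symbols. -/
def Lang.incl {S S' : Set Op} (h : S ⊆ S') (C A : Type) : Lang S C A →ᴸ Lang S' C A where
  onFunction := fun _ f => match f with
    | .zero => Func.zero
    | .one => Func.one
    | .cst c => Func.cst c
    | .aux a => Func.aux a
    | .op o => Func.op ⟨o.1, h o.2⟩
  onRelation := fun _ r => r

/-- `+, -`. -/
def addOps : Set Op := {.add, .sub}
/-- `×, ÷`. -/
def mulOps : Set Op := {.mul, .div}
/-- `+, ×`. -/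
def semiringOps : Set Op := {.add, .mul}
/-- `+, -, ×`. -/
def ringOps : Set Op := {.add, .sub, .mul}
/-- `+, -, ×, ÷`. -/
def allOps : Set Op := Set.univ

theorem subset_allOps (S : Set Op) : S ⊆ allOps := Set.subset_univ S

/-- The operations of a field; `x ÷ 0 = 0`. -/
def Op.eval {K : Type} [Field K] : Op → K → K → K
  | .add, x, y => x + y
  | .sub, x, y => x - y
  | .mul, x, y => x * y
  | .div, x, y => x / y

/-- An ordered field as a structure: the constants `c` are interpreted by `cst c`, and the unary
functions `f_a` as multiplication by `aux a`. -/
@[reducible]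
def fieldStructure (S : Set Op) {C A : Type} (K : Type) [Field K] [LinearOrder K]
    (cst : C → K) (aux : A → K) : (Lang S C A).Structure K where
  funMap := fun f x => match f, x with
    | .zero, _ => 0
    | .one, _ => 1
    | .cst c, _ => cst c
    | .aux a, x => aux a * x 0
    | .op o, x => o.1.eval (x 0) (x 1)
  RelMap := fun r x => match r, x with
    | .lt, x => x 0 < x 1

/-! ### The theories `T[F]` and `T[F]^*` -/

/-- The language of `T[F]`: `0, 1, +, -, ×, ÷, <` and `f_a` for `a ∈ F`. -/
abbrev LangT (F : Subfield ℝ) : Language := Lang allOps Empty F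

/-- The theory of the real numbers in the language `0, 1, <`, `f_a` (`a ∈ F`), and the operations
in `S`, where `f_a` is multiplication by `a`. -/
def theoryOfReals (S : Set Op) (F : Subfield ℝ) : (Lang S Empty F).Theory :=
  letI := fieldStructure S (C := Empty) (A := F) ℝ Empty.elim (fun a => (a : ℝ))
  (Lang S Empty F).completeTheory ℝ

/-- `T_add[F]`, in the language `0, 1, +, -, <, f_a`. -/
def Tadd (F : Subfield ℝ) : (Lang addOps Empty F).Theory := theoryOfReals addOps F

/-- `T_mult[F]`, in the language `0, 1, ×, ÷, <, f_a`. -/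
def Tmult (F : Subfield ℝ) : (Lang mulOps Empty F).Theory := theoryOfReals mulOps F

/-- `T[F] = T_add[F] ∪ T_mult[F]`. -/
def theoryT (F : Subfield ℝ) : (LangT F).Theory :=
  (Lang.incl (subset_allOps addOps) Empty F).onTheory (Tadd F) ∪
    (Lang.incl (subset_allOps mulOps) Empty F).onTheory (Tmult F)

/-- The language of `T[F]^*`: `0, 1, +, ×, <` and constants `c_a` for `a ∈ F`. -/
abbrev LangStar (F : Subfield ℝ) : Language := Lang semiringOps F Empty

namespace Star

variable {F : Subfield ℝ} {α : Type} {n : ℕ}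

/-- The term `0`. -/
def zero : (LangStar F).Term α := Constants.term (L := LangStar F) Func.zero
/-- The term `1`. -/
def one : (LangStar F).Term α := Constants.term (L := LangStar F) Func.one
/-- The term `c_a`. -/
def c (a : F) : (LangStar F).Term α := Constants.term (L := LangStar F) (Func.cst a)
/-- The term `s + t`. -/
def add (s t : (LangStar F).Term α) : (LangStar F).Term α :=
  Functions.apply₂ (L := LangStar F) (Func.op ⟨.add, by simp [semiringOps]⟩) s t
/-- The term `s × t`. -/
def mul (s t : (LangStar F).Term α) : (LangStar F).Term α :=
  Functions.apply₂ (L := LangStar F) (Func.op ⟨.mul, by simp [semiringOps]⟩) s t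
/-- The term `t^k`. -/
def pow (t : (LangStar F).Term α) : ℕ → (LangStar F).Term α
  | 0 => one
  | k + 1 => mul (pow t k) t
/-- The formula `s < t`. -/
def lt (s t : (LangStar F).Term (α ⊕ Fin n)) : (LangStar F).BoundedFormula α n :=
  Relations.boundedFormula₂ (L := LangStar F) Rel.lt s t

/-- `0, +, <` is an ordered abelian group. -/
def addGroup (F : Subfield ℝ) : (LangStar F).Theory :=
  { ∀' ∀' ∀' (add (add &0 &1) &2 =' add &0 (add &1 &2)),
    ∀' ∀' (add &0 &1 =' add &1 &0),
    ∀' (add zero &0 =' &0),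
    ∀' ∃' (add &0 &1 =' zero),
    ∀' ∼(lt &0 &0),
    ∀' ∀' ∀' (lt &0 &1 ⟹ lt &1 &2 ⟹ lt &0 &2),
    ∀' ∀' (lt &0 &1 ⊔ (&0 =' &1) ⊔ lt &1 &0),
    ∀' ∀' ∀' (lt &0 &1 ⟹ lt (add &0 &2) (add &1 &2)) }

/-- `×` is associative and commutative, and `1, ×, <` is a divisible ordered abelian group on the
positive elements. -/
def mulGroup (F : Subfield ℝ) : (LangStar F).Theory :=
  { ∀' ∀' ∀' (mul (mul &0 &1) &2 =' mul &0 (mul &1 &2)),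
    ∀' ∀' (mul &0 &1 =' mul &1 &0),
    lt zero one,
    ∀' ∀' (lt zero &0 ⟹ lt zero &1 ⟹ lt zero (mul &0 &1)),
    ∀' (lt zero &0 ⟹ mul one &0 =' &0),
    ∀' (lt zero &0 ⟹ ∃' (lt zero &1 ⊓ (mul &0 &1 =' one))),
    ∀' ∀' ∀' (lt zero &0 ⟹ lt &0 &1 ⟹ lt zero &2 ⟹ lt (mul &0 &2) (mul &1 &2)) } ∪
  { φ | ∃ k : ℕ, 1 ≤ k ∧ φ = ∀' (lt zero &0 ⟹ ∃' (lt zero &1 ⊓ (pow &1 k =' &0))) }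

/-- The field operations and the order of `F` on the constants. -/
def constants (F : Subfield ℝ) : (LangStar F).Theory :=
  { φ | ∃ a b : F, φ = (c (a + b) =' add (c a) (c b)) } ∪
  { φ | ∃ a b : F, φ = (c (a * b) =' mul (c a) (c b)) } ∪
  { φ | ∃ a : F, 0 < a ∧ φ = lt zero (c a) }

/-- Distributivity for the constants. -/
def distrib (F : Subfield ℝ) : (LangStar F).Theory :=
  { φ | ∃ a b : F, φ = ∀' (mul (c (a + b)) &0 =' add (mul (c a) &0) (mul (c b) &0)) } ∪
  { φ | ∃ a : F, φ = ∀' ∀' (mul (c a) (add &0 &1) =' add (mul (c a) &0) (mul (c a) &1)) }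

end Star

/-- `T[F]^*`. -/
def theoryTStar (F : Subfield ℝ) : (LangStar F).Theory :=
  Star.addGroup F ∪ Star.mulGroup F ∪ Star.constants F ∪ Star.distrib F

/-! ### Existential sentences and their representation by strings -/

/-- Names of variables: a variable is a letter with a string of binary digits as its index. -/
abbrev Var := List Bool

/-- Terms in `0, 1`, the operations in `S`, and variables from `V`. -/
inductive Tm (S : Set Op) (V : Type)
  | var (v : V) : Tm S V
  | zero : Tm S V
  | one : Tm S V
  | op (o : S) (s t : Tm S V) : Tm S V

/-- Quantifier-free formulas. -/
inductive QF (S : Set Op) (V : Type)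
  | eq (s t : Tm S V) : QF S V
  | lt (s t : Tm S V) : QF S V
  | not (φ : QF S V) : QF S V
  | and (φ ψ : QF S V) : QF S V
  | or (φ ψ : QF S V) : QF S V
  | imp (φ ψ : QF S V) : QF S V

/-- Existential sentences `∃ x₁ … ∃ xₙ φ`, where `φ` is quantifier-free and has its variables
among `x₁, …, xₙ`. Neither auxiliary constants nor auxiliary functions occur in them. -/
structure ExSentence (S : Set Op) where
  vars : List Var
  matrix : QF S {v // v ∈ vars}

section Translation

variable {S : Set Op} {V : Type} (C A : Type)

/-- A term, as a term of the first-order language. -/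
def Tm.toTerm : Tm S V → (Lang S C A).Term V
  | .var v => Term.var v
  | .zero => Constants.term (L := Lang S C A) Func.zero
  | .one => Constants.term (L := Lang S C A) Func.one
  | .op o s t => Functions.apply₂ (L := Lang S C A) (Func.op o) s.toTerm t.toTerm

/-- A quantifier-free formula, as a formula of the first-order language. -/
def QF.toFormula : QF S V → (Lang S C A).Formula V
  | .eq s t => Term.equal (s.toTerm C A) (t.toTerm C A)
  | .lt s t => Relations.formula₂ (L := Lang S C A) Rel.lt (s.toTerm C A) (t.toTerm C A)
  | .not φ => ∼φ.toFormula
  | .and φ ψ => φ.toFormula ⊓ ψ.toFormula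
  | .or φ ψ => φ.toFormula ⊔ ψ.toFormula
  | .imp φ ψ => φ.toFormula.imp ψ.toFormula

/-- An existential sentence, as a sentence of the first-order language. -/
noncomputable def ExSentence.toSentence (φ : ExSentence S) : (Lang S C A).Sentence :=
  ((φ.matrix.toFormula C A).relabel (Sum.inr : _ → Empty ⊕ {v // v ∈ φ.vars})).iExs
    {v // v ∈ φ.vars}

end Translation

/-- The finite alphabet in which sentences are written. -/
inductive Tok
  | ex | var | bit (b : Bool)
  | zero | one | op (o : Op)
  | eq | lt | not | and | or | imp
  deriving DecidableEq, Fintype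

noncomputable instance : Primcodable Tok :=
  Primcodable.ofEquiv (Fin (Fintype.card Tok)) (Fintype.equivFin Tok)

section Print

variable {S : Set Op} {V : Type} (name : V → Var)

/-- Terms are written in prefix notation. -/
def Tm.print : Tm S V → List Tok
  | .var v => Tok.var :: (name v).map Tok.bit
  | .zero => [Tok.zero]
  | .one => [Tok.one]
  | .op o s t => Tok.op o.1 :: (s.print ++ t.print)

/-- Quantifier-free formulas are written in prefix notation. -/
def QF.print : QF S V → List Tok
  | .eq s t => Tok.eq :: (s.print name ++ t.print name)
  | .lt s t => Tok.lt :: (s.print name ++ t.print name)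
  | .not φ => Tok.not :: φ.print
  | .and φ ψ => Tok.and :: (φ.print ++ ψ.print)
  | .or φ ψ => Tok.or :: (φ.print ++ ψ.print)
  | .imp φ ψ => Tok.imp :: (φ.print ++ ψ.print)

/-- The string `∃ x₁ … ∃ xₙ φ`. -/
def ExSentence.print (φ : ExSentence S) : List Tok :=
  φ.vars.flatMap (fun v => Tok.ex :: v.map Tok.bit) ++ φ.matrix.print Subtype.val

end Print

/-! ### The decision problems -/

/-- `φ` belongs to the existential theory of the ordered field `F` in `0, 1, +, -, ×, <`. -/
def InExistentialTheory (F : Subfield ℝ) (φ : ExSentence ringOps) : Prop :=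
  letI := fieldStructure ringOps (C := Empty) (A := Empty) F Empty.elim Empty.elim
  F ⊨ φ.toSentence Empty Empty

/-- `φ` is an existential consequence of `T[F]` without auxiliary functions. -/
def ConsequenceT (F : Subfield ℝ) (φ : ExSentence allOps) : Prop :=
  theoryT F ⊨ᵇ φ.toSentence Empty F

/-- `φ` is an existential consequence of `T[F]^*` without auxiliary constants. -/
def ConsequenceTStar (F : Subfield ℝ) (φ : ExSentence semiringOps) : Prop :=
  theoryTStar F ⊨ᵇ φ.toSentence F Empty

/-- A Diophantine equation `p = 0` in the listed unknowns, with `p` an integer polynomial given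
as an expression in `0, 1, +, -, ×`. -/
structure DiophantineEquation where
  unknowns : List Var
  lhs : Tm ringOps {v // v ∈ unknowns}

/-- The polynomial with integer coefficients denoted by a term. -/
noncomputable def Tm.toMvPolynomial {V : Type} : Tm ringOps V → MvPolynomial V ℤ
  | .var v => MvPolynomial.X v
  | .zero => 0
  | .one => 1
  | .op ⟨.add, _⟩ s t => s.toMvPolynomial + t.toMvPolynomial
  | .op ⟨.sub, _⟩ s t => s.toMvPolynomial - t.toMvPolynomial
  | .op ⟨.mul, _⟩ s t => s.toMvPolynomial * t.toMvPolynomial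
  | .op ⟨.div, h⟩ _ _ => absurd h (by simp [ringOps])

/-- The equation has a rational solution. -/
def DiophantineEquation.SolvableInRat (D : DiophantineEquation) : Prop :=
  ∃ x : {v // v ∈ D.unknowns} → ℚ, MvPolynomial.aeval x D.lhs.toMvPolynomial = 0

/-- The equation is written as the string `∃ x₁ … ∃ xₙ p = 0`. -/
def DiophantineEquation.print (D : DiophantineEquation) : List Tok :=
  (ExSentence.mk D.unknowns (.eq D.lhs .zero)).print

/-! ### Decidability and linear time reductions -/

/-- The problem `P`, with instances written by `enc`, is decidable: some algorithm, given the
string of an instance, tells whether `P` holds of it. -/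
def DecidableProblem {α : Type} (enc : α → List Tok) (P : α → Prop) : Prop :=
  ∃ f : List Tok → Bool, Computable f ∧ ∀ a, f (enc a) = true ↔ P a

/-- `P` is many-one reducible to `Q` by a function that some Turing machine with finitely many
stacks computes in a number of steps that is linear in the length of the input. -/
def LinearTimeReducible {α β : Type} (enc : α → List Tok) (P : α → Prop)
    (enc' : β → List Tok) (Q : β → Prop) : Prop :=
  ∃ (f : α → β) (M : Turing.TM2ComputableInTime enc enc' f),
    (∃ C : ℕ, ∀ n, M.time n ≤ C * (n + 1)) ∧ ∀ a, P a ↔ Q (f a)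

/-- The field `ℚ`, as a subfield of `ℝ`. -/
noncomputable def ratSubfield : Subfield ℝ := (algebraMap ℚ ℝ).fieldRange

end RealFragments

open RealFragments

/-! The two halves of `T[F]` share only `0`, `1`, the order and the scalars from `F`, so a model may
take its addition and its multiplication from incompatible sources, and distributivity may fail. It
cannot fail on `F`: every model of `T[F]` or `T[F]^*` contains a copy of the ordered field `F`, via
`a ↦ f_a(1)` or `a ↦ c_a`. Hence an existential sentence true in `F` stays true in all models after
adding, for each quantified `x`, the conditions `x(1 + x) = x + xx` and `x(m + x) = mx + xx`, where
`m + 1 = 0`. For the converse, one model suffices in which only elements of `F` satisfy both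
conditions.

That model is `ℝ*` with its own order, addition and scalars, and with the product transported along
the bijection `g = twist F`, that is `g⁻¹(g(x) g(y))`. Since `g` is increasing, fixes `F` and
commutes with multiplication by elements of `F`, the additive reduct is that of the field `ℝ*` and
the multiplicative reduct is isomorphic to that of `ℝ*` through `g`; by Łoś both have the theory of
`ℝ`.

On the monad of a nonzero `a ∈ F`, `g` maps `a(1 + e)` to `a(1 + e³)`; everywhere else it multiplies
by `lam`, infinitely close but not equal to `1`. If `x = a(1 + e)` with `e ≠ 0` satisfied the
condition for `c = ±1` (with `c + a ≠ 0`), comparing terms of order `e³` would give `(c + a)³ + a³ =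
(c + at)³` with `t³ = 2`, which is impossible for at least one choice of `c`
(`eq_of_distrib_of_nearField`). Away from these monads, either a factor `lam` fails to cancel or the
standard parts conflict (`mem_of_distrib`).

For linear time, the reduction acts on strings token by token, apart from one conjunct for each
variable whose length is linear in that of its name. The same rewriting is primitive recursive,
which gives undecidability; a Diophantine equation over `ℚ` is a special existential sentence. -/

section

namespace RealFragments

open FirstOrder FirstOrder.Language

/-! ### The reduction on sentences -/

section Reduce

variable {S : Set Op} {V W : Type}

/-- The term `s + t`. -/
def Tm.add (hS : semiringOps ⊆ S) (s t : Tm S V) : Tm S V :=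
  .op ⟨.add, hS (by simp [semiringOps])⟩ s t

/-- The term `s × t`. -/
def Tm.mul (hS : semiringOps ⊆ S) (s t : Tm S V) : Tm S V :=
  .op ⟨.mul, hS (by simp [semiringOps])⟩ s t

/-- Elimination of subtraction: the variable `m` stands for `-1`, and `s - t` is written as
`m × (m × s + t)`. The other variables are renamed by `r`. -/
def Tm.elimSub (hS : semiringOps ⊆ S) (m : W) (r : V → W) : Tm ringOps V → Tm S W
  | .var v => .var (r v)
  | .zero => .zero
  | .one => .one
  | .op ⟨.add, _⟩ s t => Tm.add hS (s.elimSub hS m r) (t.elimSub hS m r)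
  | .op ⟨.mul, _⟩ s t => Tm.mul hS (s.elimSub hS m r) (t.elimSub hS m r)
  | .op ⟨.sub, _⟩ s t => Tm.mul hS (.var m)
      (Tm.add hS (Tm.mul hS (.var m) (s.elimSub hS m r)) (t.elimSub hS m r))
  | .op ⟨.div, h⟩ _ _ => absurd h (by simp [ringOps])

/-- Elimination of subtraction in a formula. -/
def QF.elimSub (hS : semiringOps ⊆ S) (m : W) (r : V → W) : QF ringOps V → QF S W
  | .eq s t => .eq (s.elimSub hS m r) (t.elimSub hS m r)
  | .lt s t => .lt (s.elimSub hS m r) (t.elimSub hS m r)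
  | .not φ => .not (φ.elimSub hS m r)
  | .and φ ψ => .and (φ.elimSub hS m r) (ψ.elimSub hS m r)
  | .or φ ψ => .or (φ.elimSub hS m r) (ψ.elimSub hS m r)
  | .imp φ ψ => .imp (φ.elimSub hS m r) (ψ.elimSub hS m r)

/-- The formula `x × (c + x) = c × x + x × x`. -/
def QF.distribAt (hS : semiringOps ⊆ S) (c cx : Tm S V) (x : V) : QF S V :=
  .eq (Tm.mul hS (.var x) (Tm.add hS c (.var x)))
    (Tm.add hS cx (Tm.mul hS (.var x) (.var x)))

/-- The conjunction of `x × (1 + x) = x + x × x` and `x × (m + x) = m × x + x × x`. -/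
def QF.distributive (hS : semiringOps ⊆ S) (m x : V) : QF S V :=
  .and (QF.distribAt hS .one (.var x) x)
    (QF.distribAt hS (.var m) (Tm.mul hS (.var m) (.var x)) x)

/-- The new variables: one for `-1`, and a renamed copy of each old variable. -/
def renamedVars (vars : List Var) : List Var := [] :: vars.map (true :: ·)

/-- The variable that stands for `-1`. -/
def negOneVar (vars : List Var) : {v // v ∈ renamedVars vars} := ⟨[], by simp [renamedVars]⟩

/-- The new name of a variable. -/
def renameVar (vars : List Var) (v : {v // v ∈ vars}) : {v // v ∈ renamedVars vars} :=
  ⟨true :: v.1, by simp [renamedVars, v.2]⟩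

/-- The quantifier-free formula `m + 1 = 0 ∧ θ(x₁) ∧ … ∧ θ(xₙ) ∧ φ`, where `θ(x)` consists of
instances of distributivity and subtraction is eliminated from `φ`. -/
def QF.reduce (hS : semiringOps ⊆ S) (vars : List Var) (φ : QF ringOps {v // v ∈ vars}) :
    QF S {v // v ∈ renamedVars vars} :=
  .and (.eq (Tm.add hS (.var (negOneVar vars)) .one) .zero)
    (vars.attach.foldr
      (fun v ψ => .and (QF.distributive hS (negOneVar vars) (renameVar vars v)) ψ)
      (φ.elimSub hS (negOneVar vars) (renameVar vars)))

/-- The reduction: `∃ x₁ … ∃ xₙ φ` becomes a sentence without subtraction, which says that there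
are `m` with `m + 1 = 0` and `x₁, …, xₙ` that satisfy `φ` and instances of distributivity. -/
def ExSentence.reduce (hS : semiringOps ⊆ S) (φ : ExSentence ringOps) : ExSentence S where
  vars := renamedVars φ.vars
  matrix := φ.matrix.reduce hS φ.vars

/-! ### The reduction on strings -/

/-- The tokens that replace a token of the quantifier-free part. -/
def Tok.elimSub : Tok → List Tok
  | .var => [.var, .bit true]
  | .op .sub => [.op .mul, .var, .op .add, .op .mul, .var]
  | t => [t]

/-- The strings between the occurrences of `x` in the conjunct that belongs to `x`. -/
def distribChunks : List (List Tok) :=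
  [ [.and, .and, .eq, .op .mul], [.op .add, .one], [.op .add], [.op .mul], [],
    [.eq, .op .mul], [.op .add, .var], [.op .add, .op .mul, .var], [.op .mul], [] ]

/-- The conjunct that belongs to the variable whose name is written as `w`. -/
def distribTokens (w : List Tok) : List Tok :=
  distribChunks.flatMap fun c => c ++ Tok.var :: Tok.bit true :: w

/-- The conjunct `m + 1 = 0`. -/
def negOneTokens : List Tok := [.and, .eq, .op .add, .var, .one, .zero]

theorem Tok.flatMap_elimSub_bits (w : Var) :
    (w.map Tok.bit).flatMap Tok.elimSub = w.map Tok.bit := by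
  induction w with
  | nil => rfl
  | cons b w ih => simp [Tok.elimSub, ih]

/-- This is why `s - t` becomes `m × (m × s + t)` and not `s + m × t`: in prefix notation all new
tokens stand before `s`, so no parsing is needed to find where `s` ends. The empty name of `m` and
the extra leading bit of the other names serve the same purpose. -/
theorem Tm.print_elimSub (hS : semiringOps ⊆ S) (m : W) (r : V → W) (name : V → Var)
    (name' : W → Var) (hm : name' m = []) (hr : ∀ v, name' (r v) = true :: name v)
    (t : Tm ringOps V) :
    (t.elimSub hS m r).print name' = (t.print name).flatMap Tok.elimSub := by
  induction t with
  | var v =>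
    simp only [Tm.elimSub, Tm.print, hr, List.flatMap_cons, Tok.flatMap_elimSub_bits]
    rfl
  | zero => rfl
  | one => rfl
  | op o s t hs ht =>
    obtain ⟨o, ho⟩ := o
    cases o <;>
      simp [Tm.elimSub, Tm.print, Tm.add, Tm.mul, hs, ht, hm, Tok.elimSub] at ho ⊢
    simp [ringOps] at ho

theorem QF.print_elimSub (hS : semiringOps ⊆ S) (m : W) (r : V → W) (name : V → Var)
    (name' : W → Var) (hm : name' m = []) (hr : ∀ v, name' (r v) = true :: name v)
    (φ : QF ringOps V) :
    (φ.elimSub hS m r).print name' = (φ.print name).flatMap Tok.elimSub := by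
  induction φ <;>
    simp [QF.elimSub, QF.print, Tm.print_elimSub hS m r name name' hm hr, Tok.elimSub, *]

/-- The string splits into pieces that are computed separately: the new prefix, a constant string,
one conjunct for each name in the prefix, and the tokenwise image of the matrix. Both the machine
and the primitive recursive function produce this form. -/
theorem ExSentence.print_reduce (hS : semiringOps ⊆ S) (φ : ExSentence ringOps) :
    (φ.reduce hS).print =
      Tok.ex :: φ.vars.flatMap (fun v => Tok.ex :: Tok.bit true :: v.map Tok.bit) ++
        (negOneTokens ++ (φ.vars.flatMap (fun v => distribTokens (v.map Tok.bit)) ++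
          (φ.matrix.print Subtype.val).flatMap Tok.elimSub)) := by
  have key : ∀ l : List {v // v ∈ φ.vars}, ∀ ψ : QF S {v // v ∈ renamedVars φ.vars},
      (l.foldr (fun v ψ =>
        .and (QF.distributive hS (negOneVar φ.vars) (renameVar φ.vars v)) ψ) ψ).print Subtype.val =
      (l.map Subtype.val).flatMap (fun v => distribTokens (v.map Tok.bit)) ++
        ψ.print Subtype.val := by
    intro l ψ
    induction l with
    | nil => rfl
    | cons v l ih =>
      rw [List.foldr_cons, QF.print, ih]
      simp [QF.print, QF.distributive, QF.distribAt, Tm.print, Tm.add, Tm.mul, distribTokens,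
        distribChunks, negOneVar, renameVar]
  simp only [ExSentence.print, ExSentence.reduce, QF.reduce, QF.print, key,
    List.attach_map_subtype_val]
  rw [QF.print_elimSub hS (negOneVar φ.vars) (renameVar φ.vars) Subtype.val Subtype.val rfl
    (fun v => rfl)]
  simp [renamedVars, negOneTokens, Tm.print, Tm.add, negOneVar, List.flatMap_map]

end Reduce

/-! ### Semantics -/

section Semantics

variable {S : Set Op} {V W C A : Type}

/-- The value of a term in a field. -/
def Tm.eval {K : Type} [Field K] (v : V → K) : Tm S V → K
  | .var x => v x
  | .zero => 0
  | .one => 1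
  | .op o s t => o.1.eval (s.eval v) (t.eval v)

/-- Truth of a formula in an ordered field. -/
def QF.Holds {K : Type} [Field K] [LinearOrder K] (v : V → K) : QF S V → Prop
  | .eq s t => s.eval v = t.eval v
  | .lt s t => s.eval v < t.eval v
  | .not φ => ¬ φ.Holds v
  | .and φ ψ => φ.Holds v ∧ ψ.Holds v
  | .or φ ψ => φ.Holds v ∨ ψ.Holds v
  | .imp φ ψ => φ.Holds v → ψ.Holds v

/-- The value of a binary operation symbol in a structure. -/
def opValue {M : Type*} [(Lang S C A).Structure M] (o : S) (x y : M) : M :=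
  Structure.funMap (L := Lang S C A) (Func.op o : (Lang S C A).Functions 2) ![x, y]

/-- The order of a structure. -/
def ltValue {M : Type*} [(Lang S C A).Structure M] (x y : M) : Prop :=
  Structure.RelMap (L := Lang S C A) (Rel.lt : (Lang S C A).Relations 2) ![x, y]

/-- The constant `0` of a structure. -/
def zeroValue (S : Set Op) (C A : Type) (M : Type*) [(Lang S C A).Structure M] : M :=
  Structure.funMap (L := Lang S C A) (Func.zero : (Lang S C A).Functions 0) ![]

/-- The constant `1` of a structure. -/
def oneValue (S : Set Op) (C A : Type) (M : Type*) [(Lang S C A).Structure M] : M :=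
  Structure.funMap (L := Lang S C A) (Func.one : (Lang S C A).Functions 0) ![]

/-! ### Terms and formulas in an arbitrary structure -/

variable {M : Type*} [(Lang S C A).Structure M]

variable (C A) in
/-- The value of a term in a structure. -/
def Tm.value (v : V → M) (t : Tm S V) : M := (t.toTerm C A).realize v

@[simp]
theorem Tm.value_var (v : V → M) (x : V) : (Tm.var x : Tm S V).value C A v = v x := rfl

@[simp]
theorem Tm.value_zero (v : V → M) : (Tm.zero : Tm S V).value C A v = zeroValue S C A M := by
  simp only [Tm.value, Tm.toTerm, zeroValue, Constants.term, Term.realize]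
  congr 1
  exact Subsingleton.elim _ _

@[simp]
theorem Tm.value_one (v : V → M) : (Tm.one : Tm S V).value C A v = oneValue S C A M := by
  simp only [Tm.value, Tm.toTerm, oneValue, Constants.term, Term.realize]
  congr 1
  exact Subsingleton.elim _ _

@[simp]
theorem Tm.value_op (v : V → M) (o : S) (s t : Tm S V) :
    (Tm.op o s t).value C A v = opValue (C := C) (A := A) o (s.value C A v) (t.value C A v) :=
  Term.realize_functions_apply₂

theorem QF.realize_eq (v : V → M) (s t : Tm S V) :
    ((QF.eq s t).toFormula C A).Realize v ↔ s.value C A v = t.value C A v :=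
  Formula.realize_equal

theorem QF.realize_lt (v : V → M) (s t : Tm S V) :
    ((QF.lt s t).toFormula C A).Realize v ↔
      ltValue (S := S) (C := C) (A := A) (s.value C A v) (t.value C A v) :=
  Formula.realize_rel₂

theorem QF.realize_not (v : V → M) (φ : QF S V) :
    ((QF.not φ).toFormula C A).Realize v ↔ ¬ (φ.toFormula C A).Realize v :=
  Formula.realize_not

theorem QF.realize_and (v : V → M) (φ ψ : QF S V) :
    ((QF.and φ ψ).toFormula C A).Realize v ↔
      (φ.toFormula C A).Realize v ∧ (ψ.toFormula C A).Realize v :=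
  Formula.realize_inf

theorem QF.realize_or (v : V → M) (φ ψ : QF S V) :
    ((QF.or φ ψ).toFormula C A).Realize v ↔
      (φ.toFormula C A).Realize v ∨ (ψ.toFormula C A).Realize v :=
  Formula.realize_sup

theorem QF.realize_imp (v : V → M) (φ ψ : QF S V) :
    ((QF.imp φ ψ).toFormula C A).Realize v ↔
      ((φ.toFormula C A).Realize v → (ψ.toFormula C A).Realize v) :=
  Formula.realize_imp

theorem ExSentence.realize_iff (φ : ExSentence S) :
    M ⊨ φ.toSentence C A ↔ ∃ v : {v // v ∈ φ.vars} → M, (φ.matrix.toFormula C A).Realize v := by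
  simp only [ExSentence.toSentence, Sentence.Realize]
  rw [Formula.realize_iExs]
  refine exists_congr fun v => ?_
  rw [Formula.realize_relabel]
  rfl

theorem inExistentialTheory_iff (F : Subfield ℝ) (φ : ExSentence ringOps) :
    InExistentialTheory F φ ↔ ∃ v : {v // v ∈ φ.vars} → F, φ.matrix.Holds v := by
  let _ := fieldStructure ringOps (C := Empty) (A := Empty) F Empty.elim Empty.elim
  have ht : ∀ (v : {v // v ∈ φ.vars} → F) (t : Tm ringOps {v // v ∈ φ.vars}),
      t.value Empty Empty v = t.eval v := by
    intro v t
    induction t with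
    | var x => rfl
    | zero => simp; rfl
    | one => simp; rfl
    | op o s t hs ht => simp only [Tm.value_op, hs, ht, Tm.eval]; rfl
  have hφ : ∀ (v : {v // v ∈ φ.vars} → F) (ψ : QF ringOps {v // v ∈ φ.vars}),
      (ψ.toFormula Empty Empty).Realize v ↔ ψ.Holds v := by
    intro v ψ
    induction ψ with
    | eq s t => rw [QF.realize_eq, ht, ht]; rfl
    | lt s t => rw [QF.realize_lt, ht, ht]; rfl
    | not φ h => rw [QF.realize_not, h]; rfl
    | and φ ψ h h' => rw [QF.realize_and, h, h']; rfl
    | or φ ψ h h' => rw [QF.realize_or, h, h']; rfl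
    | imp φ ψ h h' => rw [QF.realize_imp, h, h']; rfl
  exact (ExSentence.realize_iff φ).trans (exists_congr fun v => hφ v _)

/-- Maps from an ordered field to a structure that respect `0, 1, +, ×, <`. -/
structure FieldEmbedding (C A : Type) (hS : semiringOps ⊆ S) {M : Type*}
    [(Lang S C A).Structure M] {K : Type} [Field K] [LinearOrder K] (ι : K → M) : Prop where
  map_zero : ι 0 = zeroValue S C A M
  map_one : ι 1 = oneValue S C A M
  map_add : ∀ a b, ι (a + b) =
    opValue (C := C) (A := A) (⟨.add, hS (by simp [semiringOps])⟩ : S) (ι a) (ι b)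
  map_mul : ∀ a b, ι (a * b) =
    opValue (C := C) (A := A) (⟨.mul, hS (by simp [semiringOps])⟩ : S) (ι a) (ι b)
  map_lt : ∀ a b, ltValue (S := S) (C := C) (A := A) (ι a) (ι b) ↔ a < b
  injective : Function.Injective ι

variable {K : Type} [Field K] [LinearOrder K]

/-- No ring law is assumed in `M`. All values stay in the image of `ι`, so the identity behind the
elimination of subtraction is only needed in `K`. -/
theorem FieldEmbedding.value_elimSub {hS : semiringOps ⊆ S} {ι : K → M}
    (h : FieldEmbedding C A hS ι) {m : W} {r : V → W} {v : V → K} {w : W → M}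
    (hm : w m = ι (-1)) (hr : ∀ x, w (r x) = ι (v x)) (t : Tm ringOps V) :
    (t.elimSub hS m r).value C A w = ι (t.eval v) := by
  induction t with
  | var x => exact hr x
  | zero => simp [Tm.elimSub, Tm.eval, h.map_zero]
  | one => simp [Tm.elimSub, Tm.eval, h.map_one]
  | op o s t hs ht =>
    obtain ⟨o, ho⟩ := o
    cases o
    · simp [Tm.elimSub, Tm.eval, Tm.add, Op.eval, hs, ht, h.map_add]
    · simp only [Tm.elimSub, Tm.eval, Tm.add, Tm.mul, Op.eval, hs, ht, Tm.value_op, Tm.value_var,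
        hm, ← h.map_add, ← h.map_mul]
      congr 1
      ring
    · simp [Tm.elimSub, Tm.eval, Tm.mul, Op.eval, hs, ht, h.map_mul]
    · simp [ringOps] at ho

theorem FieldEmbedding.realize_elimSub {hS : semiringOps ⊆ S} {ι : K → M}
    (h : FieldEmbedding C A hS ι) {m : W} {r : V → W} {v : V → K} {w : W → M}
    (hm : w m = ι (-1)) (hr : ∀ x, w (r x) = ι (v x)) (φ : QF ringOps V) :
    ((φ.elimSub hS m r).toFormula C A).Realize w ↔ φ.Holds v := by
  induction φ with
  | eq s t =>
    rw [QF.elimSub, QF.realize_eq, h.value_elimSub hm hr, h.value_elimSub hm hr, h.injective.eq_iff]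
    rfl
  | lt s t =>
    rw [QF.elimSub, QF.realize_lt, h.value_elimSub hm hr, h.value_elimSub hm hr, h.map_lt]
    rfl
  | not φ h => rw [QF.elimSub, QF.realize_not, h]; rfl
  | and φ ψ h h' => rw [QF.elimSub, QF.realize_and, h, h']; rfl
  | or φ ψ h h' => rw [QF.elimSub, QF.realize_or, h, h']; rfl
  | imp φ ψ h h' => rw [QF.elimSub, QF.realize_imp, h, h']; rfl

theorem realize_foldr_and {α : Type} (l : List α) (θ : α → QF S V) (ψ : QF S V) (w : V → M) :
    ((l.foldr (fun a ψ => .and (θ a) ψ) ψ).toFormula C A).Realize w ↔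
      (∀ a ∈ l, ((θ a).toFormula C A).Realize w) ∧ (ψ.toFormula C A).Realize w := by
  induction l with
  | nil => simp
  | cons a l ih => simp [QF.realize_and, ih, and_assoc]

variable (C A) in
/-- The instances of distributivity `x × (1 + x) = x + x × x` and `x × (m + x) = m × x + x × x`. -/
def Distributive (hS : semiringOps ⊆ S) {M : Type*} [(Lang S C A).Structure M] (m x : M) : Prop :=
  let add := opValue (M := M) (C := C) (A := A) (⟨.add, hS (by simp [semiringOps])⟩ : S)
  let mul := opValue (M := M) (C := C) (A := A) (⟨.mul, hS (by simp [semiringOps])⟩ : S)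
  mul x (add (oneValue S C A M) x) = add x (mul x x) ∧
    mul x (add m x) = add (mul m x) (mul x x)

theorem ExSentence.realize_reduce_iff (hS : semiringOps ⊆ S) (φ : ExSentence ringOps) :
    M ⊨ (φ.reduce hS).toSentence C A ↔ ∃ w : {v // v ∈ renamedVars φ.vars} → M,
      opValue (C := C) (A := A) (⟨.add, hS (by simp [semiringOps])⟩ : S) (w (negOneVar φ.vars))
        (oneValue S C A M) = zeroValue S C A M ∧
      (∀ x, Distributive C A hS (w (negOneVar φ.vars)) (w (renameVar φ.vars x))) ∧
      ((φ.matrix.elimSub hS (negOneVar φ.vars) (renameVar φ.vars)).toFormula C A).Realize w := by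
  refine (ExSentence.realize_iff _).trans
    (exists_congr fun w : {v // v ∈ renamedVars φ.vars} → M => ?_)
  change ((φ.matrix.reduce hS φ.vars).toFormula C A).Realize w ↔ _
  rw [QF.reduce, QF.realize_and, realize_foldr_and]
  simp only [List.mem_attach, true_imp_iff, QF.distributive, QF.distribAt, QF.realize_and,
    QF.realize_eq, Tm.add, Tm.mul, Tm.value_op, Tm.value_var, Tm.value_one, Tm.value_zero,
    Distributive]

/-- An existential sentence true in a field gives a reduced sentence true in all structures in
which the field embeds. -/
theorem FieldEmbedding.realize_reduce {hS : semiringOps ⊆ S} {ι : K → M}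
    (h : FieldEmbedding C A hS ι) {φ : ExSentence ringOps} (v : {v // v ∈ φ.vars} → K)
    (hv : φ.matrix.Holds v) : M ⊨ (φ.reduce hS).toSentence C A := by
  classical
  let w : {v // v ∈ renamedVars φ.vars} → M := fun x =>
    -- The default value serves the variable for `-1`: its name is empty, hence not a renamed name.
    if hx : ∃ y, renameVar φ.vars y = x then ι (v hx.choose) else ι (-1)
  have hm : w (negOneVar φ.vars) = ι (-1) := by
    refine dif_neg ?_
    rintro ⟨y, hy⟩
    simpa [renameVar, negOneVar] using congrArg Subtype.val hy
  have hr : ∀ x, w (renameVar φ.vars x) = ι (v x) := by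
    intro x
    have hx : ∃ y, renameVar φ.vars y = renameVar φ.vars x := ⟨x, rfl⟩
    have : hx.choose = x := by
      have := hx.choose_spec
      simpa [renameVar, Subtype.ext_iff] using this
    simp only [w, dif_pos hx, this]
  refine (ExSentence.realize_reduce_iff hS φ).2
    ⟨w, ?_, fun x => ?_, (h.realize_elimSub hm hr _).2 hv⟩
  · rw [hm, ← h.map_one, ← h.map_zero, ← h.map_add]
    simp
  · simp only [Distributive, hm, hr, ← h.map_one, ← h.map_add, ← h.map_mul]
    exact ⟨congrArg ι (by ring), congrArg ι (by ring)⟩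

/-- If only the elements of the field satisfy the instances of distributivity, then the truth of
the reduced sentence implies that of the given one. -/
theorem FieldEmbedding.exists_holds {hS : semiringOps ⊆ S} {ι : K → M}
    (h : FieldEmbedding C A hS ι)
    (hneg : ∀ m : M, opValue (C := C) (A := A) (⟨.add, hS (by simp [semiringOps])⟩ : S) m
      (oneValue S C A M) = zeroValue S C A M → m = ι (-1))
    (hdist : ∀ x : M, Distributive C A hS (ι (-1)) x → ∃ a, ι a = x)
    {φ : ExSentence ringOps} (hφ : M ⊨ (φ.reduce hS).toSentence C A) :
    ∃ v : {v // v ∈ φ.vars} → K, φ.matrix.Holds v := by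
  obtain ⟨w, h1, h2, h3⟩ := (ExSentence.realize_reduce_iff hS φ).1 hφ
  have hm := hneg _ h1
  have hr : ∀ x, ∃ a, ι a = w (renameVar φ.vars x) := fun x => hdist _ (hm ▸ h2 x)
  choose v hv using hr
  exact ⟨v, (h.realize_elimSub hm (fun x => (hv x).symm) _).1 h3⟩

end Semantics

end RealFragments

open ArchimedeanClass Hyperreal

namespace RealFragments

/-! ### Hyperreal numbers near a real number -/

section Near

/-- The hyperreal number `x` is finite with standard part `r`. -/
def Near (x : ℝ*) (r : ℝ) : Prop := 0 ≤ ArchimedeanClass.mk x ∧ stdPart x = r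

namespace Near

variable {x y : ℝ*} {r s : ℝ}

theorem coe (r : ℝ) : Near r r := ⟨archimedeanClassMk_coe_nonneg r, stdPart_coe r⟩

theorem add (hx : Near x r) (hy : Near y s) : Near (x + y) (r + s) :=
  ⟨(le_min hx.1 hy.1).trans (min_le_mk_add _ _), by rw [stdPart_add hx.1 hy.1, hx.2, hy.2]⟩

theorem mul (hx : Near x r) (hy : Near y s) : Near (x * y) (r * s) :=
  ⟨by rw [mk_mul]; exact add_nonneg hx.1 hy.1, by rw [stdPart_mul hx.1 hy.1, hx.2, hy.2]⟩

theorem neg (hx : Near x r) : Near (-x) (-r) :=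
  ⟨by rw [mk_neg]; exact hx.1, by rw [stdPart_neg, hx.2]⟩

theorem sub (hx : Near x r) (hy : Near y s) : Near (x - y) (r - s) := by
  rw [sub_eq_add_neg, sub_eq_add_neg]
  exact hx.add hy.neg

theorem pow (hx : Near x r) (n : ℕ) : Near (x ^ n) (r ^ n) := by
  induction n with
  | zero => simpa using coe 1
  | succ n ih => simpa [pow_succ] using ih.mul hx

/-- `stdPart` vanishes outside the Archimedean class `0`, so a nonzero standard part excludes
infinitesimals, whose inverses are infinite. -/
theorem inv (hx : Near x r) (hr : r ≠ 0) : Near x⁻¹ r⁻¹ := by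
  have : ArchimedeanClass.mk x = 0 := by
    by_contra h
    exact hr (hx.2 ▸ stdPart_eq_zero.2 h)
  exact ⟨by rw [mk_inv, this, neg_zero], by rw [stdPart_inv, hx.2]⟩

theorem div (hx : Near x r) (hy : Near y s) (hs : s ≠ 0) : Near (x / y) (r / s) := by
  rw [div_eq_mul_inv, div_eq_mul_inv]
  exact hx.mul (hy.inv hs)

theorem unique (hx : Near x r) (hx' : Near x s) : r = s := hx.2.symm.trans hx'.2

theorem lt (hx : Near x r) (hy : Near y s) (h : r < s) : x < y := by
  obtain ⟨t, h1, h2⟩ := exists_between h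
  have hx' := lt_of_stdPart_lt coeRingHom hx.1 (hx.2.symm ▸ h1)
  have hy' := lt_of_lt_stdPart coeRingHom hy.1 (hy.2.symm ▸ h2)
  exact hx'.trans hy'

theorem le (hx : Near x r) (hy : Near y s) (h : x ≤ y) : r ≤ s := by
  by_contra! h'
  exact (hy.lt hx h').not_ge h

theorem of_le_of_le {a b : ℝ} (h : (a : ℝ*) ≤ x) (h' : x ≤ b) : Near x (stdPart x) :=
  ⟨mk_nonneg_of_le_of_le_of_archimedean coeRingHom h h', rfl⟩

theorem of_sq_near (h : Near (x ^ 2) r) : Near x (stdPart x) := by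
  have h1 : x ^ 2 < ((r + 1 : ℝ) : ℝ*) := h.lt (coe _) (by linarith)
  have h2 : |x| ≤ ((r + 2 : ℝ) : ℝ*) := by
    have h0 : 0 ≤ r := Near.le (coe 0) h (by simpa using sq_nonneg x)
    have h0' : (0 : ℝ*) ≤ (r : ℝ*) := by exact_mod_cast h0
    refine abs_le_of_sq_le_sq' ?_ ?_ |> abs_le.2
    · push_cast at h1 ⊢
      nlinarith
    · push_cast
      linarith
  refine of_le_of_le (a := -(r + 2)) (b := r + 2) ?_ (abs_le.1 h2).2
  have := (abs_le.1 h2).1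
  push_cast at this ⊢
  exact this

/-- A number between two reals is finite, so crude bounds suffice: `-1 < x³ < r + 1` forces `-1 ≤ x
≤ r + 2`. -/
theorem of_cube_near (h : Near (x ^ 3) r) (hr : 0 ≤ r) : Near x (stdPart x) := by
  have h1 : x ^ 3 < ((r + 1 : ℝ) : ℝ*) := h.lt (coe _) (by linarith)
  have h2 : ((-1 : ℝ) : ℝ*) < x ^ 3 := (coe _).lt h (by linarith)
  have h0' : (0 : ℝ*) ≤ (r : ℝ*) := by exact_mod_cast hr
  push_cast at h1 h2
  refine of_le_of_le (a := -1) (b := r + 2) ?_ ?_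
  · push_cast
    by_contra! h
    nlinarith [sq_nonneg (x + 1), sq_nonneg x]
  · push_cast
    by_contra! h
    nlinarith [sq_nonneg (x + 1), sq_nonneg x, mul_self_nonneg (x - 1)]

theorem inv_of_not_near (h : ∀ r, ¬ Near x r) : Near x⁻¹ 0 := by
  have h1 : ArchimedeanClass.mk x < 0 := by
    by_contra! h'
    exact h _ ⟨h', rfl⟩
  have h2 : 0 < ArchimedeanClass.mk x⁻¹ := by
    rw [mk_inv]
    simpa using Or.inl h1
  exact ⟨h2.le, stdPart_eq_zero.2 h2.ne'⟩

end Near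

/-- Roots are taken coordinatewise in the ultrapower; the coordinates where the representative is
not positive form a negligible set. -/
theorem exists_pow_eq_hyperreal {k : ℕ} (hk : 1 ≤ k) {y : ℝ*} (hy : 0 < y) :
    ∃ x : ℝ*, 0 < x ∧ x ^ k = y := by
  obtain ⟨f, rfl⟩ := ofSeq_surjective y
  have hf : ∀ᶠ n in Filter.hyperfilter ℕ, 0 < f n := ofSeq_lt_ofSeq.1 hy
  refine ⟨ofSeq fun n => f n ^ (k⁻¹ : ℝ), ?_, ?_⟩
  · refine ofSeq_lt_ofSeq.2 (hf.mono fun n hn => ?_)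
    exact Real.rpow_pos_of_pos hn _
  · change ofSeq (fun n => (f n ^ (k⁻¹ : ℝ)) ^ k) = ofSeq f
    refine Filter.Germ.coe_eq.2 (hf.mono fun n hn => ?_)
    exact Real.rpow_inv_natCast_pow hn.le (by omega)

theorem exists_cube_eq_hyperreal (y : ℝ*) : ∃ x : ℝ*, x ^ 3 = y := by
  rcases lt_trichotomy y 0 with h | h | h
  · obtain ⟨x, -, hx⟩ := exists_pow_eq_hyperreal (k := 3) (by norm_num) (neg_pos.2 h)
    exact ⟨-x, by rw [Odd.neg_pow (by decide), hx, neg_neg]⟩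
  · exact ⟨0, by simp [h]⟩
  · obtain ⟨x, -, hx⟩ := exists_pow_eq_hyperreal (k := 3) (by norm_num) h
    exact ⟨x, hx⟩

end Near

/-! ### An order automorphism of the hyperreal numbers -/

section Twist

/-- A number infinitely close to `1`. -/
noncomputable def lam : ℝ* := 1 + epsilon

theorem near_lam : Near lam 1 := by
  have : Near epsilon 0 := ⟨archimedeanClassMk_epsilon_pos.le, stdPart_epsilon⟩
  simpa [lam] using (Near.coe 1).add this

theorem lam_ne_one : lam ≠ 1 := by simp [lam]

theorem lam_pos : 0 < lam := add_pos one_pos epsilon_pos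

variable (F : Subfield ℝ)

/-- The hyperreal number `x` is infinitely close to a nonzero element of `F`. -/
def NearField (x : ℝ*) : Prop := stdPart x ∈ F ∧ stdPart x ≠ 0

open Classical in
/-- An order automorphism of the hyperreal numbers that commutes with multiplication by elements
of `F` but does not respect addition. -/
noncomputable def twist (x : ℝ*) : ℝ* :=
  if NearField F x then stdPart x + (x - stdPart x) ^ 3 / stdPart x ^ 2 else lam * x

variable {F}

/-- Infinite numbers have standard part `0` by convention, so the condition `stdPart x ≠ 0` already
implies finiteness. -/
theorem NearField.near {x : ℝ*} (h : NearField F x) : Near x (stdPart x) :=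
  ⟨(not_not.1 (stdPart_eq_zero.not.1 h.2)).ge, rfl⟩

theorem Near.nearField_iff {x : ℝ*} {a : ℝ} (hx : Near x a) : NearField F x ↔ a ∈ F ∧ a ≠ 0 := by
  rw [NearField, hx.2]

theorem twist_of_near {x : ℝ*} {a : ℝ} (hx : Near x a) (ha : a ∈ F) (h0 : a ≠ 0) :
    twist F x = a + (x - a) ^ 3 / a ^ 2 := by
  rw [twist, if_pos (hx.nearField_iff.2 ⟨ha, h0⟩), hx.2]

theorem twist_of_not {x : ℝ*} (hx : ¬ NearField F x) : twist F x = lam * x := if_neg hx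

/-- On finite numbers both branches of `twist` change the argument by an infinitesimal only. -/
theorem Near.twist {x : ℝ*} {a : ℝ} (hx : Near x a) : Near (twist F x) a := by
  by_cases h : NearField F x
  · obtain ⟨ha, h0⟩ := hx.nearField_iff.1 h
    rw [twist_of_near hx ha h0]
    have := (Near.coe a).add (((hx.sub (Near.coe a)).pow 3).div ((Near.coe a).pow 2)
      (pow_ne_zero 2 h0))
    simpa using this
  · rw [twist_of_not h]
    simpa using near_lam.mul hx

theorem near_twist_iff {x : ℝ*} {a : ℝ} : Near (twist F x) a ↔ Near x a := by
  refine ⟨fun h => ?_, Near.twist⟩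
  by_cases hx : NearField F x
  · have := hx.near
    rwa [h.unique this.twist]
  · rw [twist_of_not hx] at h
    have := h.div near_lam one_ne_zero
    rwa [mul_div_cancel_left₀ _ lam_pos.ne', div_one] at this

theorem twist_coe {a : ℝ} (ha : a ∈ F) : twist F a = a := by
  by_cases h0 : a = 0
  · subst h0
    rw [twist_of_not fun h => h.2 (by simp)]
    simp
  · rw [twist_of_near (Near.coe a) ha h0]
    simp

/-- Multiplication by a nonzero `a ∈ F` permutes the monads of the nonzero elements of `F`, and `b +
(x - b)³ / b²` is homogeneous of degree one in `(x, b)`; this is the role of the denominator `b²`.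
The other branch is linear. -/
theorem twist_mul {a : ℝ} (ha : a ∈ F) (x : ℝ*) : twist F (a * x) = a * twist F x := by
  by_cases h0 : a = 0
  · subst h0
    have := twist_coe (F := F) (zero_mem F)
    simpa using this
  have h0' : (a : ℝ*) ≠ 0 := by exact_mod_cast h0
  by_cases hx : NearField F x
  · have hn := hx.near
    obtain ⟨hb, hb0⟩ := hx
    have hb0' : (stdPart x : ℝ*) ≠ 0 := by exact_mod_cast hb0
    rw [twist_of_near hn hb hb0, twist_of_near ((Near.coe a).mul hn) (mul_mem ha hb)
      (mul_ne_zero h0 hb0)]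
    push_cast
    field_simp
  · rw [twist_of_not hx, twist_of_not]
    · ring
    · intro h
      have hn := ((Near.coe a).inv h0).mul h.near
      rw [inv_mul_cancel_left₀ h0'] at hn
      exact hx (hn.nearField_iff.2
        ⟨mul_mem (inv_mem ha) h.1, mul_ne_zero (inv_ne_zero h0) h.2⟩)

/-- Standard parts are preserved, so numbers in distinct monads keep their order. Within a monad,
cubing the deviation and scaling by `lam` are both increasing. An infinite number stays on the same
side of every real. -/
theorem twist_strictMono : StrictMono (twist F) := by
  intro x y hxy
  have key : ∀ {x y : ℝ*} {a b : ℝ}, Near x a → Near y b → x < y → a ≠ b →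
      twist F x < twist F y := fun hx hy h hab =>
    hx.twist.lt hy.twist (lt_of_le_of_ne (hx.le hy h.le) hab)
  have hab_lt : ∀ {x : ℝ*} (r : ℝ), (∀ r, ¬ Near x r) → (r : ℝ*) ≤ x → (r : ℝ*) < twist F x := by
    intro x r hx hr
    rw [twist_of_not fun h => hx _ h.near]
    by_contra! h
    -- Otherwise `lam * x ≤ r`, and since `lam ≥ 1`, `x` would lie between two reals and be finite.
    have h1 : x ≤ ((max r 0 : ℝ) : ℝ*) := by
      rcases le_or_gt x 0 with h0 | h0
      · exact h0.trans (by exact_mod_cast le_max_right _ _)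
      · have : x ≤ lam * x := by
          have : 1 ≤ lam := by simpa [lam] using epsilon_pos.le
          nlinarith
        exact (this.trans h).trans (by exact_mod_cast le_max_left _ _)
    exact hx _ (Near.of_le_of_le hr h1)
  have hab_gt : ∀ {x : ℝ*} (r : ℝ), (∀ r, ¬ Near x r) → x ≤ (r : ℝ*) → twist F x < (r : ℝ*) := by
    intro x r hx hr
    -- The lower side follows from the upper one because `twist` is odd, as `-1 ∈ F`.
    have h1 := hab_lt (x := -x) (-r) (fun s hs => hx (-s) (by simpa using hs.neg))
      (by push_cast; exact neg_le_neg hr)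
    have h2 : twist F (-x) = - twist F x := by
      have := twist_mul (neg_mem (one_mem F)) x
      simpa using this
    rw [h2] at h1
    push_cast at h1
    exact neg_lt_neg_iff.1 h1
  by_cases hx : NearField F x <;> by_cases hy : NearField F y
  · by_cases hab : stdPart x = stdPart y
    · have hy' := hy.near
      rw [← hab] at hy'
      rw [twist_of_near hx.near hx.1 hx.2, twist_of_near hy' hx.1 hx.2]
      have h0 : (stdPart x : ℝ*) ≠ 0 := by exact_mod_cast hx.2
      have : (x - stdPart x) ^ 3 < (y - stdPart x) ^ 3 :=
        Odd.strictMono_pow (by decide) (sub_lt_sub_right hxy _)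
      gcongr
    · exact key hx.near hy.near hxy hab
  · by_cases hf : ∃ r, Near y r
    · obtain ⟨r, hr⟩ := hf
      refine key hx.near hr hxy ?_
      rintro rfl
      exact hy (hr.nearField_iff.2 hx)
    · push Not at hf
      have h1 : x < ((stdPart x + 1 : ℝ) : ℝ*) := hx.near.lt (Near.coe _) (by linarith)
      have h2 : twist F x < ((stdPart x + 1 : ℝ) : ℝ*) :=
        hx.near.twist.lt (Near.coe _) (by linarith)
      have h3 : ((stdPart x + 1 : ℝ) : ℝ*) ≤ y := by
        by_contra! h
        refine hf _ (Near.of_le_of_le (a := stdPart x - 1) ?_ h.le)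
        exact ((Near.coe _).lt hx.near (by linarith)).le.trans hxy.le
      exact h2.trans (hab_lt _ hf h3)
  · by_cases hf : ∃ r, Near x r
    · obtain ⟨r, hr⟩ := hf
      refine key hr hy.near hxy ?_
      rintro rfl
      exact hx (hr.nearField_iff.2 hy)
    · push Not at hf
      have h2 : ((stdPart y - 1 : ℝ) : ℝ*) < twist F y :=
        (Near.coe _).lt hy.near.twist (by linarith)
      have h3 : x ≤ ((stdPart y - 1 : ℝ) : ℝ*) := by
        by_contra! h
        refine hf _ (Near.of_le_of_le (b := stdPart y + 1) h.le ?_)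
        exact hxy.le.trans (hy.near.lt (Near.coe _) (by linarith)).le
      exact (hab_gt _ hf h3).trans h2
  · rw [twist_of_not hx, twist_of_not hy]
    exact mul_lt_mul_of_pos_left hxy lam_pos

/-- Near `a`, the preimage of `y` is `a + w` with `w³ = a²(y - a)`; such a `w` is infinitesimal, so
`a + w` falls under the same branch. -/
theorem twist_surjective : Function.Surjective (twist F) := by
  intro y
  by_cases hy : NearField F y
  · obtain ⟨w, hw⟩ := exists_cube_eq_hyperreal (stdPart y ^ 2 * (y - stdPart y))
    have h0 : (stdPart y : ℝ*) ≠ 0 := by exact_mod_cast hy.2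
    have hw0 : Near (w ^ 3) 0 := by
      rw [hw]
      simpa using ((Near.coe (stdPart y)).pow 2).mul (hy.near.sub (Near.coe (stdPart y)))
    have hw1 := Near.of_cube_near hw0 le_rfl
    have hw2 : stdPart w = 0 := pow_eq_zero_iff (three_ne_zero) |>.1 ((hw1.pow 3).unique hw0)
    rw [hw2] at hw1
    have hn : Near (stdPart y + w) (stdPart y) := by simpa using (Near.coe (stdPart y)).add hw1
    refine ⟨stdPart y + w, ?_⟩
    rw [twist_of_near hn hy.1 hy.2, add_sub_cancel_left, hw]
    field_simp
    ring
  · refine ⟨y / lam, ?_⟩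
    rw [twist_of_not, mul_div_cancel₀ _ lam_pos.ne']
    intro h
    have := near_lam.mul h.near
    rw [mul_div_cancel₀ _ lam_pos.ne', one_mul] at this
    exact hy (this.nearField_iff.2 h)

/-- Near a nonzero element `a` of `F`, the instances of distributivity hold at `a` only. -/
theorem eq_of_distrib_of_nearField {x z : ℝ*} (hx : NearField F x)
    (hz : twist F z = twist F x ^ 2)
    (h : ∀ c : ℝ, c = 1 ∨ c = -1 → twist F x * twist F (c + x) = twist F (c * x + z)) :
    x = stdPart x := by
  have hn := hx.near
  obtain ⟨ha, h0⟩ := hx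
  generalize stdPart x = a at *
  have h0' : (a : ℝ*) ≠ 0 := by exact_mod_cast h0
  by_contra hne
  have hzn : Near z (a ^ 2) := near_twist_iff.1 (hz ▸ hn.twist.pow 2)
  -- Relative deviations: `x = a(1 + e)` and `z = a²(1 + e')`. In these coordinates `twist` cubes
  -- the deviation.
  set e : ℝ* := (x - a) / a with he
  have he0 : e ≠ 0 := div_ne_zero (sub_ne_zero.2 hne) h0'
  have hen : Near e 0 := by simpa using (hn.sub (Near.coe a)).div (Near.coe a) h0
  have hxe : x = a * (1 + e) := by rw [he]; field_simp; ring
  set e' : ℝ* := (z - a ^ 2) / a ^ 2 with he'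
  have hze : z = a ^ 2 * (1 + e') := by rw [he']; field_simp; ring
  have hgx : twist F x = a * (1 + e ^ 3) := by
    rw [twist_of_near hn ha h0, hxe]
    field_simp
    ring
  have hgz : twist F z = a ^ 2 * (1 + e' ^ 3) := by
    rw [twist_of_near hzn (pow_mem ha 2) (pow_ne_zero 2 h0), hze,
      show ((a ^ 2 : ℝ) : ℝ*) = (a : ℝ*) ^ 2 from map_pow coeRingHom a 2]
    field_simp
    ring
  -- Since `z` is the twisted square of `x`, `1 + (ρe)³ = (1 + e³)²`. So `ρ³ = 2 + e³`, and the
  -- standard part `t` of `ρ` is the cube root of `2`.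
  set ρ : ℝ* := e' / e with hρ
  have he'ρ : e' = ρ * e := by rw [hρ]; field_simp
  have hρ3 : ρ ^ 3 = 2 + e ^ 3 := by
    rw [hgx, hgz, he'ρ] at hz
    have h1 : (1 + (ρ * e) ^ 3) = (1 + e ^ 3) ^ 2 := by
      have h2 : (a : ℝ*) ^ 2 * (1 + (ρ * e) ^ 3) = a ^ 2 * (1 + e ^ 3) ^ 2 := by rw [hz]; ring
      exact mul_left_cancel₀ (pow_ne_zero 2 h0') h2
    have h2 : e ^ 3 * ρ ^ 3 = e ^ 3 * (2 + e ^ 3) := by linear_combination h1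
    exact mul_left_cancel₀ (pow_ne_zero 3 he0) h2
  have hρ2 : Near (ρ ^ 3) 2 := by
    rw [hρ3]
    have : Near (2 : ℝ*) 2 := Near.coe 2
    simpa using this.add (hen.pow 3)
  have ht := Near.of_cube_near hρ2 (by norm_num)
  generalize stdPart ρ = t at ht
  have ht3 : t ^ 3 = 2 := (ht.pow 3).unique hρ2
  have ht1 : t ≠ 1 := by rintro rfl; norm_num at ht3
  have ht2 : t ≠ -2 := by rintro rfl; norm_num at ht3
  -- The first condition keeps `c + x` and `c * x + z` near nonzero elements of `F`; the second
  -- makes the final factor nonzero. For `a = 1` take `c = 1` and for `a = -1` take `c = -1`, where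
  -- `t ≠ -2` is used. For other `a`, the second condition cannot fail for both signs. This is why
  -- two instances of distributivity are required.
  obtain ⟨c, hc, hc1, hc2⟩ :
      ∃ c : ℝ, (c = 1 ∨ c = -1) ∧ c + a ≠ 0 ∧ a * (1 + t) + c ≠ 0 := by
    by_contra! hcon
    have h1 := hcon 1 (Or.inl rfl)
    have h2 := hcon (-1) (Or.inr rfl)
    by_cases ha1 : 1 + a = 0
    · obtain rfl : a = -1 := by linarith
      have := h2 (by norm_num)
      exact ht2 (by linarith)
    · have h1 := h1 ha1
      by_cases ha2 : -1 + a = 0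
      · obtain rfl : a = 1 := by linarith
        exact ht2 (by linarith)
      · have := h2 ha2
        linarith
  have hcF : c ∈ F := by
    rcases hc with rfl | rfl
    · exact one_mem F
    · exact neg_mem (one_mem F)
  have hc0 : c ≠ 0 := by rcases hc with rfl | rfl <;> norm_num
  have hc1' : (c : ℝ*) + a ≠ 0 := by exact_mod_cast hc1
  have hgc : twist F (c + x) = (c + a) + (a * e) ^ 3 / (c + a) ^ 2 := by
    rw [twist_of_near ((Near.coe c).add hn) (add_mem hcF ha) hc1, hxe]
    push_cast
    ring
  have hgw : twist F (c * x + z) =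
      a * (c + a) + (a * (c * e + a * e')) ^ 3 / (a * (c + a)) ^ 2 := by
    have hw : Near (c * x + z) (a * (c + a)) := by
      convert ((Near.coe c).mul hn).add hzn using 1
      ring
    rw [twist_of_near hw (mul_mem ha (add_mem hcF ha)) (mul_ne_zero h0 hc1), hxe, hze]
    push_cast
    ring
  have heq := h c hc
  rw [hgx, hgc, hgw, he'ρ] at heq
  -- Distributivity with denominators cleared and the common factor `e³` cancelled.
  have h1 : ((c : ℝ*) + a) ^ 3 + a ^ 3 + (a * e) ^ 3 = (c + a * ρ) ^ 3 := by
    field_simp at heq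
    refine mul_left_cancel₀ (pow_ne_zero 3 he0) ?_
    linear_combination heq
  have h2 : Near (((c : ℝ*) + a) ^ 3 + a ^ 3 + (a * e) ^ 3) ((c + a) ^ 3 + a ^ 3 + (a * 0) ^ 3) :=
    ((((Near.coe c).add (Near.coe a)).pow 3).add ((Near.coe a).pow 3)).add
      (((Near.coe a).mul hen).pow 3)
  have h3 : (c + a) ^ 3 + a ^ 3 + (a * 0) ^ 3 = (c + a * t) ^ 3 :=
    h2.unique (h1 ▸ ((Near.coe c).add ((Near.coe a).mul ht)).pow 3)
  -- The cubic terms cancel after taking standard parts, because `t³ = 2`.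
  have h4 : 3 * a * c * ((1 - t) * (a * (1 + t) + c)) = 0 := by
    linear_combination h3 + a ^ 3 * ht3
  have h5 : (1 - t) * (a * (1 + t) + c) ≠ 0 := mul_ne_zero (sub_ne_zero.2 ht1.symm) hc2
  exact mul_ne_zero (mul_ne_zero (mul_ne_zero three_ne_zero h0) hc0) h5 h4

/-- Only elements of `F` satisfy the instances of distributivity for addition and the
multiplication that is transported along `twist F`. -/
theorem mem_of_distrib {x z : ℝ*} (hz : twist F z = twist F x ^ 2)
    (h : ∀ c : ℝ, c = 1 ∨ c = -1 → twist F x * twist F (c + x) = twist F (c * x + z)) :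
    ∃ a ∈ F, (a : ℝ*) = x := by
  by_cases hx : NearField F x
  · exact ⟨stdPart x, hx.1, (eq_of_distrib_of_nearField hx hz h).symm⟩
  by_cases hx0 : x = 0
  · exact ⟨0, zero_mem F, by simp [hx0]⟩
  exfalso
  have hcF : ∀ c : ℝ, c = 1 ∨ c = -1 → c ∈ F ∧ c ≠ 0 := by
    rintro c (rfl | rfl)
    · exact ⟨one_mem F, by norm_num⟩
    · exact ⟨neg_mem (one_mem F), by norm_num⟩
  have hlx := twist_of_not hx
  -- A nonzero standard part of `x` lies outside `F`, and so do its translates by elements of `F`.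
  have hirr : ∀ {r c b : ℝ}, Near x r → r ≠ 0 → c = 1 ∨ c = -1 → b ∈ F → c * r + b ∉ F := by
    intro r c b hr hr0 hc hb hmem
    refine hx (hr.nearField_iff.2 ⟨?_, hr0⟩)
    obtain ⟨hc, hc0⟩ := hcF c hc
    have := mul_mem (inv_mem hc) (sub_mem hmem hb)
    rwa [add_sub_cancel_right, inv_mul_cancel_left₀ hc0] at this
  have hcx : ∀ {r c : ℝ}, Near x r → r ≠ 0 → c = 1 ∨ c = -1 → ¬ NearField F (c + x) := by
    intro r c hr hr0 hc hcon
    have := (((Near.coe c).add hr).nearField_iff.1 hcon).1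
    exact hirr hr hr0 (Or.inl rfl) (hcF c hc).1 (by rwa [one_mul, add_comm])
  by_cases hzF : NearField F z
  · have hb := hzF.near
    obtain ⟨hbF, hb0⟩ := hzF
    generalize stdPart z = b at *
    have hxb : Near (x ^ 2) b := by
      have := (hz ▸ hb.twist).div (near_lam.pow 2) (by norm_num)
      rw [hlx, mul_pow, mul_div_cancel_left₀ _ (pow_ne_zero 2 lam_pos.ne')] at this
      simpa using this
    have hr := Near.of_sq_near hxb
    generalize stdPart x = r at hr
    have hr0 : r ≠ 0 := by
      rintro rfl
      exact hb0 (hxb.unique (by simpa using hr.pow 2))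
    -- Here `x`, `c + x` and `c * x + z` are all merely scaled by `lam`. Subtracting the cases `c =
    -- 1` and `c = -1` leaves `lam * x = x`.
    have key : ∀ c : ℝ, c = 1 ∨ c = -1 → z = lam * x * (c + x) - c * x := by
      intro c hc
      have h1 := h c hc
      rw [hlx, twist_of_not (hcx hr hr0 hc), twist_of_not] at h1
      · refine mul_left_cancel₀ lam_pos.ne' ?_
        linear_combination -h1
      · intro hcon
        exact hirr hr hr0 hc hbF ((((Near.coe c).mul hr).add hb).nearField_iff.1 hcon).1
    have h1 := key 1 (Or.inl rfl)
    have h2 := key (-1) (Or.inr rfl)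
    push_cast at h1 h2
    refine lam_ne_one (mul_right_cancel₀ hx0 ?_)
    linear_combination (h2 - h1) / 2
  have hzx : z = lam * x ^ 2 := by
    rw [twist_of_not hzF, hlx] at hz
    refine mul_left_cancel₀ lam_pos.ne' ?_
    linear_combination hz
  -- If both sums were merely scaled by `lam`, the identity would reduce to `lam * c * x = c * x`.
  have key : ∀ c : ℝ, c = 1 ∨ c = -1 → ¬ NearField F (c + x) → NearField F (c * x + z) := by
    intro c hc h1
    by_contra h2
    have h3 := h c hc
    rw [hlx, twist_of_not h1, twist_of_not h2, hzx] at h3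
    have hc0 : (c : ℝ*) ≠ 0 := by exact_mod_cast (hcF c hc).2
    refine lam_ne_one (mul_right_cancel₀ (mul_ne_zero (mul_ne_zero lam_pos.ne' hc0) hx0) ?_)
    linear_combination h3
  by_cases hfin : ∃ r, Near x r
  · obtain ⟨r, hr⟩ := hfin
    have hzr : Near z (r ^ 2) := by
      rw [hzx]
      simpa using near_lam.mul (hr.pow 2)
    -- For infinitesimal `x`, `1 + x` lies near `1 ∈ F` and is sent to `1 + x³`; the identity then
    -- gives `x² = lam`, which is not infinitesimal.
    by_cases hr0 : r = 0
    · subst hr0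
      have h1 : Near (1 + x) 1 := by simpa using (Near.coe 1).add hr
      have h2 := h 1 (Or.inl rfl)
      push_cast at h2
      rw [hlx, twist_of_near h1 (one_mem F) one_ne_zero, twist_of_not, hzx] at h2
      · have h3 : x ^ 2 = lam := by
          refine mul_left_cancel₀ (mul_ne_zero lam_pos.ne' (pow_ne_zero 2 hx0)) ?_
          push_cast at h2
          linear_combination h2
        have := (h3 ▸ hr.pow 2).unique near_lam
        norm_num at this
      · intro hcon
        have h4 : Near (1 * x + z) 0 := by simpa using hr.add hzr
        exact (h4.nearField_iff.1 hcon).2 rfl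
    -- The difference of the two memberships is `2 * r ∈ F`, although `r ∉ F`.
    · have key' : ∀ c : ℝ, c = 1 ∨ c = -1 → c * r + r ^ 2 ∈ F := fun c hc =>
        ((((Near.coe c).mul hr).add hzr).nearField_iff.1 (key c hc (hcx hr hr0 hc))).1
      have h1 := sub_mem (key' 1 (Or.inl rfl)) (key' (-1) (Or.inr rfl))
      have h2 := mul_mem (inv_mem (add_mem (one_mem F) (one_mem F))) h1
      refine hirr hr hr0 (Or.inl rfl) (zero_mem F) ?_
      convert h2 using 1
      ring
  · push Not at hfin
    -- For infinite `x`, `x + lam * x²` would be finite; dividing by `x²` makes `x⁻¹ + lam`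
    -- infinitesimal, but it is near `1`.
    have hw := Near.inv_of_not_near hfin
    have h1 : ¬ NearField F ((1 : ℝ) + x) := by
      intro hcon
      refine hfin (stdPart ((1 : ℝ) + x) - 1) ?_
      simpa using hcon.near.sub (Near.coe 1)
    have h2 := (key 1 (Or.inl rfl) h1).near
    generalize stdPart ((1 : ℝ) * x + z) = b at h2
    have h3 := (hw.pow 2).mul h2
    have h4 : x⁻¹ ^ 2 * ((1 : ℝ) * x + z) = x⁻¹ + lam := by
      rw [hzx]
      push_cast
      field_simp
    rw [h4] at h3
    have := h3.unique (hw.add near_lam)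
    norm_num at this

end Twist

end RealFragments

namespace RealFragments

open FirstOrder FirstOrder.Language

/-! ### The model of `T[F]` and `T[F]^*` -/

section Model

variable (F : Subfield ℝ)

/-- The order automorphism `twist F`, as an isomorphism of orders. -/
noncomputable def twistIso : ℝ* ≃o ℝ* :=
  StrictMono.orderIsoOfSurjective (twist F) twist_strictMono twist_surjective

theorem twistIso_apply (x : ℝ*) : twistIso F x = twist F x := rfl

/-- Addition and subtraction of hyperreal numbers, and multiplication and division transported along
`twist F`. -/
noncomputable def twistedOp : Op → ℝ* → ℝ* → ℝ*
  | .add, x, y => x + y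
  | .sub, x, y => x - y
  | .mul, x, y => (twistIso F).symm (twist F x * twist F y)
  | .div, x, y => (twistIso F).symm (twist F x / twist F y)

/-- The hyperreal numbers with the operations `twistedOp F`, constants `cst c` and unary functions
`x ↦ aux a * x`. -/
@[reducible]
noncomputable def twistedStructure (S : Set Op) {C A : Type} (cst : C → F) (aux : A → F) :
    (Lang S C A).Structure ℝ* where
  funMap := fun f x => match f, x with
    | .zero, _ => (0 : ℝ*)
    | .one, _ => (1 : ℝ*)
    | .cst c, _ => ((cst c : ℝ) : ℝ*)
    | .aux a, x => ((aux a : ℝ) : ℝ*) * (x 0 : ℝ*)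
    | .op o, x => twistedOp F o.1 (x 0) (x 1)
  RelMap := fun r x => match r, x with
    | .lt, x => (x 0 : ℝ*) < (x 1 : ℝ*)

theorem twisted_mul_coe {a : ℝ} (ha : a ∈ F) (x : ℝ*) : twistedOp F .mul a x = a * x := by
  rw [twistedOp, twist_coe ha, OrderIso.symm_apply_eq, twistIso_apply, twist_mul ha]

theorem fieldEmbedding_twisted {S : Set Op} {C A : Type} (cst : C → F) (aux : A → F)
    (hS : semiringOps ⊆ S) :
    let _ := twistedStructure F S cst aux
    FieldEmbedding C A hS (M := ℝ*) (fun a : F => ((a : ℝ) : ℝ*)) := by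
  intro _
  refine ⟨?_, ?_, ?_, ?_, ?_, ?_⟩
  · exact coe_zero
  · exact coe_one
  · intro a b
    exact coe_add _ _
  · intro a b
    refine Eq.trans ?_ (twisted_mul_coe F a.2 b).symm
    exact coe_mul _ _
  · intro a b
    exact Hyperreal.coe_lt_coe
  · intro a b h
    exact Subtype.ext (coe_eq_coe.1 h)

/-- Addition is the ordinary one, so the witness for `-1` is `-1`. Applying `twist` to the two
instances of distributivity gives the hypotheses of `mem_of_distrib`, with `z` the twisted square of
`x`. -/
theorem exists_holds_of_twisted {S : Set Op} {C A : Type} (cst : C → F) (aux : A → F)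
    (hS : semiringOps ⊆ S) {φ : ExSentence ringOps}
    (h : letI := twistedStructure F S cst aux
      ℝ* ⊨ (φ.reduce hS).toSentence C A) : InExistentialTheory F φ := by
  rw [inExistentialTheory_iff]
  let _ := twistedStructure F S cst aux
  refine (fieldEmbedding_twisted F cst aux hS).exists_holds ?_ ?_ h
  · intro m hm
    have hm : (m + 1 : ℝ*) = 0 := hm
    change (m : ℝ*) = (((-1 : F) : ℝ) : ℝ*)
    push_cast
    exact eq_neg_of_add_eq_zero_left hm
  · intro x hx
    obtain ⟨h1, h2⟩ := hx
    have key : ∀ x : ℝ*, twistedOp F .mul x (1 + x) = x + twistedOp F .mul x x →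
        twistedOp F .mul x ((((-1 : F) : ℝ) : ℝ*) + x) =
          twistedOp F .mul (((-1 : F) : ℝ) : ℝ*) x + twistedOp F .mul x x →
        ∃ a : F, ((a : ℝ) : ℝ*) = x := by
      intro x h1 h2
      rw [twisted_mul_coe F (-1 : F).2] at h2
      have hz : twist F (twistedOp F .mul x x) = twist F x ^ 2 := by
        rw [← twistIso_apply, twistedOp, OrderIso.apply_symm_apply, sq]
      obtain ⟨a, ha, hax⟩ := mem_of_distrib hz (by
        rintro c (rfl | rfl)
        · have := congrArg (twist F) h1
          rw [← twistIso_apply, twistedOp, OrderIso.apply_symm_apply] at this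
          simpa using this
        · have := congrArg (twist F) h2
          rw [← twistIso_apply, twistedOp, OrderIso.apply_symm_apply] at this
          simpa using this)
      exact ⟨⟨a, ha⟩, hax⟩
    exact key x h1 h2

/-- The ultrapower of the ordered field `ℝ` that underlies the hyperreal numbers. -/
theorem hyperreal_realize_iff (S : Set Op) (φ : (Lang S Empty F).Sentence) :
    (letI := fieldStructure S (C := Empty) (A := F) ℝ* Empty.elim (fun a => ((a : ℝ) : ℝ*));
      ℝ* ⊨ φ) ↔
    (letI := fieldStructure S (C := Empty) (A := F) ℝ Empty.elim (fun a => (a : ℝ));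
      ℝ ⊨ φ) := by
  let _ := fieldStructure S (C := Empty) (A := F) ℝ* Empty.elim (fun a => ((a : ℝ) : ℝ*))
  let _ := fieldStructure S (C := Empty) (A := F) ℝ Empty.elim (fun a => (a : ℝ))
  -- The carriers agree by definition; only the interpretations of the symbols must be compared, on
  -- representing sequences.
  let e : ((Filter.hyperfilter ℕ : Filter ℕ).Product fun _ => ℝ) ≃[Lang S Empty F] ℝ* :=
    { toEquiv := Equiv.refl _
      map_fun' := by
        intro n f x
        choose y hy using fun i => Hyperreal.ofSeq_surjective (x i)
        obtain rfl : (fun i => ofSeq (y i)) = x := funext hy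
        refine (Ultraproduct.funMap_cast f y).trans ?_
        cases f with
        | zero => rfl
        | one => rfl
        | cst c => exact c.elim
        | aux a => rfl
        | op o =>
          obtain ⟨o, ho⟩ := o
          cases o <;> rfl
      map_rel' := by
        intro n r x
        choose y hy using fun i => Hyperreal.ofSeq_surjective (x i)
        obtain rfl : (fun i => ofSeq (y i)) = x := funext hy
        cases r
        have h := @relMap_quotient_mk' (Lang S Empty F) (ℕ → ℝ)
          ((Filter.hyperfilter ℕ : Filter ℕ).productSetoid fun _ => ℝ)
          (Ultraproduct.setoidPrestructure _ _) 2 Rel.lt y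
        exact Hyperreal.ofSeq_lt_ofSeq.trans h.symm }
  refine (StrongHomClass.realize_sentence e φ).symm.trans ?_
  -- Łoś's theorem; all factors are equal, so the sentence holds in almost all of them exactly when
  -- it holds in `ℝ`.
  rw [Ultraproduct.sentence_realize]
  simp

/-- The structure on the hyperreal numbers that is a model of `T[F]`. -/
@[reducible]
noncomputable def twistedLangT : (LangT F).Structure ℝ* :=
  twistedStructure F allOps (C := Empty) (A := F) Empty.elim id

theorem twisted_model_onTheory_iff (S : Set Op) :
    (letI := twistedLangT F;
      ℝ* ⊨ (Lang.incl (subset_allOps S) Empty F).onTheory (theoryOfReals S F)) ↔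
    (letI := twistedStructure F S (C := Empty) (A := F) Empty.elim id;
      ℝ* ⊨ theoryOfReals S F) := by
  let _ := twistedLangT F
  let _ := twistedStructure F S (C := Empty) (A := F) Empty.elim id
  have : (Lang.incl (subset_allOps S) Empty F).IsExpansionOn ℝ* :=
    ⟨fun f x => by cases f <;> rfl, fun r x => by cases r; rfl⟩
  exact LHom.onTheory_model _ _

/-- If `e` is an isomorphism from the twisted structure to the field of hyperreal numbers, in the
language with the operations in `S`, then the twisted structure has the theory of `ℝ`. -/
theorem twisted_model_theoryOfReals (S : Set Op) (e : ℝ* ≃o ℝ*) (h0 : e 0 = 0) (h1 : e 1 = 1)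
    (haux : ∀ (a : F) (x : ℝ*), e ((a : ℝ) * x) = (a : ℝ) * e x)
    (hop : ∀ o ∈ S, ∀ x y, e (twistedOp F o x y) = o.eval (e x) (e y)) :
    letI := twistedStructure F S (C := Empty) (A := F) Empty.elim id
    ℝ* ⊨ theoryOfReals S F := by
  let i₁ := twistedStructure F S (C := Empty) (A := F) Empty.elim id
  let i₂ := fieldStructure S (C := Empty) (A := F) ℝ* Empty.elim (fun a => ((a : ℝ) : ℝ*))
  let e' : @FirstOrder.Language.Equiv (Lang S Empty F) ℝ* ℝ* i₁ i₂ :=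
    @FirstOrder.Language.Equiv.mk (Lang S Empty F) ℝ* ℝ* i₁ i₂ e.toEquiv
      (by
        intro n f x
        cases f with
        | zero => exact h0
        | one => exact h1
        | cst c => exact c.elim
        | aux a => exact haux a _
        | op o => exact hop o.1 o.2 _ _)
      (by
        intro n r x
        cases r
        exact e.lt_iff_lt)
  refine (@Theory.model_iff _ _ i₁ _).2 fun φ hφ => ?_
  refine (@StrongHomClass.realize_sentence _ _ _ i₁ i₂ _ _ _ e' φ).2 ?_
  exact (hyperreal_realize_iff F S φ).2 hφ

/-- Each reduct is isomorphic to the corresponding reduct of the field `ℝ*`, but by different maps: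
the identity for addition and `twist F` for multiplication. -/
theorem twisted_model_theoryT : letI := twistedLangT F; ℝ* ⊨ theoryT F := by
  let _ := twistedLangT F
  have hadd : ℝ* ⊨ (Lang.incl (subset_allOps addOps) Empty F).onTheory (Tadd F) := by
    refine (twisted_model_onTheory_iff F addOps).2
      (twisted_model_theoryOfReals F addOps (OrderIso.refl _) rfl rfl (fun _ _ => rfl) ?_)
    rintro o (rfl | rfl) x y <;> rfl
  have hmul : ℝ* ⊨ (Lang.incl (subset_allOps mulOps) Empty F).onTheory (Tmult F) := by
    refine (twisted_model_onTheory_iff F mulOps).2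
      (twisted_model_theoryOfReals F mulOps (twistIso F) ?_ ?_
        (fun a x => twist_mul a.2 x) ?_)
    · exact twist_coe (zero_mem F)
    · exact twist_coe (one_mem F)
    · rintro o (rfl | rfl) x y <;> exact OrderIso.apply_symm_apply _ _
  exact hadd.union hmul

end Model

end RealFragments

namespace RealFragments

open FirstOrder FirstOrder.Language

/-! ### `F` embeds in the models of `T[F]` -/

section EmbeddingT

variable {F : Subfield ℝ}

/-- The term `f_a(1)`. -/
def auxTerm (S : Set Op) (a : F) : (Lang S Empty F).Term Empty :=
  Functions.apply₁ (L := Lang S Empty F) (Func.aux a : (Lang S Empty F).Functions 1)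
    (Constants.term (L := Lang S Empty F) Func.one)

/-- The value of `f_a(1)`. -/
def auxValue (S : Set Op) (M : Type*) [(Lang S Empty F).Structure M] (a : F) : M :=
  Structure.funMap (L := Lang S Empty F) (Func.aux a : (Lang S Empty F).Functions 1)
    ![oneValue S Empty F M]

theorem realize_auxTerm (S : Set Op) {M : Type*} [(Lang S Empty F).Structure M] (a : F)
    (v : Empty → M) : (auxTerm S a).realize v = auxValue S M a := by
  refine Term.realize_functions_apply₁.trans ?_
  exact congrArg (fun x => Structure.funMap (L := Lang S Empty F)
    (Func.aux a : (Lang S Empty F).Functions 1) ![x]) (Tm.value_one v)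

theorem auxValue_real (S : Set Op) (a : F) :
    letI := fieldStructure S (C := Empty) (A := F) ℝ Empty.elim (fun a => (a : ℝ))
    auxValue S ℝ a = (a : ℝ) :=
  mul_one (a : ℝ)

/-- The reducts of models of `T[F]` have the same theory as `ℝ`. -/
theorem realize_iff_of_model {S : Set Op} {M : Type*} [(LangT F).Structure M]
    (hM : M ⊨ (Lang.incl (subset_allOps S) Empty F).onTheory (theoryOfReals S F))
    (φ : (Lang S Empty F).Sentence) :
    (letI := (Lang.incl (subset_allOps S) Empty F).reduct M; M ⊨ φ) ↔
    (letI := fieldStructure S (C := Empty) (A := F) ℝ Empty.elim (fun a => (a : ℝ)); ℝ ⊨ φ) := by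
  let _ := (Lang.incl (subset_allOps S) Empty F).reduct M
  let _ := fieldStructure S (C := Empty) (A := F) ℝ Empty.elim (fun a => (a : ℝ))
  have h : M ⊨ theoryOfReals S F := (LHom.onTheory_model _ _).1 hM
  have key : ∀ {φ : (Lang S Empty F).Sentence}, ℝ ⊨ φ → M ⊨ φ := fun hφ =>
    Theory.realize_sentence_of_mem (theoryOfReals S F) hφ
  refine ⟨fun hφ => ?_, key⟩
  by_contra hn
  exact (Sentence.realize_not M).1 (key ((Sentence.realize_not ℝ).2 hn)) hφ

theorem realize_eq_iff_of_model {S : Set Op} {M : Type*} [(LangT F).Structure M]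
    (hM : M ⊨ (Lang.incl (subset_allOps S) Empty F).onTheory (theoryOfReals S F))
    (s t : (Lang S Empty F).Term Empty) :
    (letI := (Lang.incl (subset_allOps S) Empty F).reduct M;
      s.realize (Empty.elim : Empty → M) = t.realize Empty.elim) ↔
    (letI := fieldStructure S (C := Empty) (A := F) ℝ Empty.elim (fun a => (a : ℝ));
      s.realize (Empty.elim : Empty → ℝ) = t.realize Empty.elim) := by
  let _ := (Lang.incl (subset_allOps S) Empty F).reduct M
  let _ := fieldStructure S (C := Empty) (A := F) ℝ Empty.elim (fun a => (a : ℝ))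
  have := realize_iff_of_model hM (s.equal t)
  rw [Sentence.Realize, Sentence.Realize, Formula.realize_equal, Formula.realize_equal] at this
  convert this

/-- `F` embeds in the models of `T[F]`. -/
theorem fieldEmbedding_of_theoryT {M : Type*} [(LangT F).Structure M] (hM : M ⊨ theoryT F)
    (hS : semiringOps ⊆ allOps) : FieldEmbedding Empty F hS (auxValue (F := F) allOps M) := by
  have hadd := hM.mono (T := (Lang.incl (subset_allOps addOps) Empty F).onTheory (Tadd F))
    Set.subset_union_left
  have hmul := hM.mono (T := (Lang.incl (subset_allOps mulOps) Empty F).onTheory (Tmult F))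
    Set.subset_union_right
  let _ := (Lang.incl (subset_allOps addOps) Empty F).reduct M
  let iR (S : Set Op) := fieldStructure S (C := Empty) (A := F) ℝ Empty.elim (fun a => (a : ℝ))
  -- An operation table of `F`, written with the closed terms `f_a(1)`, consists of sentences true
  -- in `ℝ`. Sums are transferred by `Tadd` and products by `Tmult`.
  have hbin : ∀ {S : Set Op} (o : S)
      (_ : M ⊨ (Lang.incl (subset_allOps S) Empty F).onTheory (theoryOfReals S F)) (a b c : F),
      (c : ℝ) = o.1.eval (a : ℝ) (b : ℝ) → auxValue allOps M c =
        opValue (S := allOps) (C := Empty) (A := F)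
        ⟨o.1, subset_allOps S o.2⟩ (auxValue allOps M a) (auxValue allOps M b) := by
    intro S o hM a b c h
    let _ := (Lang.incl (subset_allOps S) Empty F).reduct M
    have := (realize_eq_iff_of_model hM (auxTerm S c) (Functions.apply₂ (L := Lang S Empty F)
      (Func.op o : (Lang S Empty F).Functions 2) (auxTerm S a) (auxTerm S b))).2 (by
        refine Eq.trans ?_ Term.realize_functions_apply₂.symm
        rw [realize_auxTerm, realize_auxTerm, realize_auxTerm, auxValue_real, auxValue_real,
          auxValue_real, h]
        rfl)
    replace this := this.trans Term.realize_functions_apply₂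
    rwa [realize_auxTerm, realize_auxTerm, realize_auxTerm] at this
  refine ⟨?_, ?_, fun a b => ?_, fun a b => ?_, fun a b => ?_, fun a b h => ?_⟩
  · have := (realize_eq_iff_of_model hadd (auxTerm addOps 0)
      (Constants.term (L := Lang addOps Empty F) Func.zero)).2 (by
        rw [realize_auxTerm, auxValue_real]
        exact (Tm.value_zero (S := addOps) (C := Empty) (A := F) (Empty.elim : Empty → ℝ)).symm)
    rw [realize_auxTerm] at this
    exact this.trans (Tm.value_zero _)
  · have := (realize_eq_iff_of_model hadd (auxTerm addOps 1)
      (Constants.term (L := Lang addOps Empty F) Func.one)).2 (by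
        rw [realize_auxTerm, auxValue_real]
        exact (Tm.value_one (S := addOps) (C := Empty) (A := F) (Empty.elim : Empty → ℝ)).symm)
    rw [realize_auxTerm] at this
    exact this.trans (Tm.value_one _)
  · exact hbin (S := addOps) ⟨.add, by simp [addOps]⟩ hadd a b (a + b) rfl
  · exact hbin (S := mulOps) ⟨.mul, by simp [mulOps]⟩ hmul a b (a * b) rfl
  · have := realize_iff_of_model hadd (Relations.formula₂ (L := Lang addOps Empty F) Rel.lt
      (auxTerm addOps a) (auxTerm addOps b))
    refine (Iff.trans ?_ this).trans ?_
    · refine Iff.trans ?_ Formula.realize_rel₂.symm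
      rw [realize_auxTerm, realize_auxTerm]
      rfl
    · refine Formula.realize_rel₂.trans ?_
      rw [realize_auxTerm, realize_auxTerm, auxValue_real, auxValue_real]
      exact Iff.rfl
  · have := (realize_eq_iff_of_model hadd (auxTerm addOps a) (auxTerm addOps b)).1 (by
      rw [realize_auxTerm, realize_auxTerm]
      exact h)
    rw [realize_auxTerm, realize_auxTerm, auxValue_real, auxValue_real] at this
    exact Subtype.ext this

/-- The reduction to the existential consequences of `T[F]`. -/
theorem consequenceT_reduce_iff (F : Subfield ℝ) (hS : semiringOps ⊆ allOps)
    (φ : ExSentence ringOps) : ConsequenceT F (φ.reduce hS) ↔ InExistentialTheory F φ := by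
  constructor
  · intro h
    refine exists_holds_of_twisted F (C := Empty) (A := F) Empty.elim id hS ?_
    let _ := twistedLangT F
    have := twisted_model_theoryT F
    exact h.realize_sentence ℝ*
  · intro h
    obtain ⟨v, hv⟩ := (inExistentialTheory_iff F φ).1 h
    refine Theory.models_sentence_iff.2 fun M => ?_
    exact (fieldEmbedding_of_theoryT M.is_model hS).realize_reduce v hv

end EmbeddingT

/-! ### The theory `T[F]^*` -/

section EmbeddingStar

variable {F : Subfield ℝ}

section

variable {M : Type*} [(LangStar F).Structure M] {α : Type} (v : α → M)

/-- The sum in a model of `T[F]^*`. -/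
def starAdd (x y : M) : M :=
  opValue (S := semiringOps) (C := F) (A := Empty) ⟨.add, by simp [semiringOps]⟩ x y

/-- The product in a model of `T[F]^*`. -/
def starMul (x y : M) : M :=
  opValue (S := semiringOps) (C := F) (A := Empty) ⟨.mul, by simp [semiringOps]⟩ x y

variable (M) in
/-- The constant `0` in a model of `T[F]^*`. -/
abbrev starZero : M := zeroValue semiringOps F Empty M

variable (M) in
/-- The constant `1` in a model of `T[F]^*`. -/
abbrev starOne : M := oneValue semiringOps F Empty M

variable (M) in
/-- The constant `c_a` in a model of `T[F]^*`. -/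
def starConst (a : F) : M :=
  Structure.funMap (L := LangStar F) (Func.cst a : (LangStar F).Functions 0) ![]

/-- The order in a model of `T[F]^*`. -/
abbrev starLT (x y : M) : Prop := ltValue (S := semiringOps) (C := F) (A := Empty) x y

theorem Star.realize_zero : (Star.zero : (LangStar F).Term α).realize v = starZero (F := F) M :=
  Tm.value_zero v

theorem Star.realize_one : (Star.one : (LangStar F).Term α).realize v = starOne (F := F) M :=
  Tm.value_one v

theorem Star.realize_c (a : F) : (Star.c a : (LangStar F).Term α).realize v = starConst M a := by
  simp only [Star.c, starConst, Constants.term, Term.realize]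
  congr 1
  exact Subsingleton.elim _ _

theorem Star.realize_add (s t : (LangStar F).Term α) :
    (Star.add s t).realize v = starAdd (F := F) (s.realize v) (t.realize v) :=
  Term.realize_functions_apply₂

theorem Star.realize_mul (s t : (LangStar F).Term α) :
    (Star.mul s t).realize v = starMul (F := F) (s.realize v) (t.realize v) :=
  Term.realize_functions_apply₂

/-- Powers in a model of `T[F]^*`. -/
def starPow (x : M) : ℕ → M
  | 0 => starOne (F := F) M
  | k + 1 => starMul (F := F) (starPow x k) x

theorem Star.realize_pow (t : (LangStar F).Term α) (k : ℕ) :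
    (Star.pow t k).realize v = starPow (F := F) (t.realize v) k := by
  induction k with
  | zero => exact Star.realize_one v
  | succ k ih => rw [Star.pow, Star.realize_mul, ih, starPow]

theorem Star.realize_lt {n : ℕ} (s t : (LangStar F).Term (α ⊕ Fin n)) (xs : Fin n → M) :
    (Star.lt s t).Realize v xs ↔
      starLT (F := F) (s.realize (Sum.elim v xs)) (t.realize (Sum.elim v xs)) :=
  BoundedFormula.realize_rel₂

end

variable (F) in
/-- What it means to be a model of `T[F]^*`. -/
structure StarModel (M : Type*) (zero one : M) (c : F → M) (add mul : M → M → M)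
    (lt : M → M → Prop) (pow : M → ℕ → M) : Prop where
  add_assoc : ∀ x y z, add (add x y) z = add x (add y z)
  add_comm : ∀ x y, add x y = add y x
  zero_add : ∀ x, add zero x = x
  exists_neg : ∀ x, ∃ y, add x y = zero
  lt_irrefl : ∀ x, ¬ lt x x
  lt_trans : ∀ x y z, lt x y → lt y z → lt x z
  lt_trichotomy : ∀ x y, (lt x y ∨ x = y) ∨ lt y x
  add_lt_add : ∀ x y z, lt x y → lt (add x z) (add y z)
  mul_assoc : ∀ x y z, mul (mul x y) z = mul x (mul y z)
  mul_comm : ∀ x y, mul x y = mul y x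
  zero_lt_one : lt zero one
  mul_pos : ∀ x y, lt zero x → lt zero y → lt zero (mul x y)
  one_mul : ∀ x, lt zero x → mul one x = x
  exists_inv : ∀ x, lt zero x → ∃ y, lt zero y ∧ mul x y = one
  mul_lt_mul : ∀ x y z, lt zero x → lt x y → lt zero z → lt (mul x z) (mul y z)
  exists_root : ∀ k : ℕ, 1 ≤ k → ∀ x, lt zero x → ∃ y, lt zero y ∧ pow y k = x
  c_add : ∀ a b, c (a + b) = add (c a) (c b)
  c_mul : ∀ a b, c (a * b) = mul (c a) (c b)
  c_pos : ∀ a, 0 < a → lt zero (c a)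
  add_distrib : ∀ a b x, mul (c (a + b)) x = add (mul (c a) x) (mul (c b) x)
  distrib_add : ∀ a x y, mul (c a) (add x y) = add (mul (c a) x) (mul (c a) y)

theorem model_theoryTStar_iff {M : Type*} [(LangStar F).Structure M] :
    M ⊨ theoryTStar F ↔ StarModel F M (starZero (F := F) M) (starOne (F := F) M) (starConst M)
      (starAdd (F := F)) (starMul (F := F)) (starLT (F := F)) (starPow (F := F)) := by
  -- These equivalences let `simp` turn the axiom schemes into families of conditions on the model.
  have e₂ : ∀ f : F → F → (LangStar F).Sentence,
      (∀ x a b, x = f a b → M ⊨ x) ↔ ∀ a b, M ⊨ f a b := fun f =>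
    ⟨fun h a b => h _ a b rfl, fun h _ a b hx => hx ▸ h a b⟩
  have e₁ : ∀ f : F → (LangStar F).Sentence,
      (∀ x a, 0 < a → x = f a → M ⊨ x) ↔ ∀ a, 0 < a → M ⊨ f a := fun f =>
    ⟨fun h a ha => h _ a ha rfl, fun h _ a ha hx => hx ▸ h a ha⟩
  have e₀ : ∀ f : ℕ → (LangStar F).Sentence,
      (∀ x a, 1 ≤ a → x = f a → M ⊨ x) ↔ ∀ a, 1 ≤ a → M ⊨ f a := fun f =>
    ⟨fun h a ha => h _ a ha rfl, fun h _ a ha hx => hx ▸ h a ha⟩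
  simp only [theoryTStar, Theory.model_iff, Set.mem_union, or_imp, forall_and, Star.addGroup,
    Star.mulGroup, Star.constants, Star.distrib, Set.mem_insert_iff, Set.mem_singleton_iff,
    forall_eq, Set.mem_ofPred_eq, forall_exists_index, and_imp, forall_eq_apply_imp_iff, e₂, e₁, e₀]
  simp only [Sentence.Realize, Formula.Realize, BoundedFormula.realize_all,
    BoundedFormula.realize_ex,
    BoundedFormula.realize_imp, BoundedFormula.realize_not, BoundedFormula.realize_inf,
    BoundedFormula.realize_sup, BoundedFormula.realize_bdEqual, Star.realize_lt, Star.realize_add,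
    Star.realize_mul, Star.realize_pow, Star.realize_c, Star.realize_zero, Star.realize_one,
    Function.comp_apply, Term.realize_var, Sum.elim_inr]
  constructor
  · rintro ⟨⟨⟨⟨h1, h2, h3, h4, h5, h6, h7, h8⟩, ⟨h9, h10, h11, h12, h13, h14, h15⟩, h16⟩,
      ⟨h17, h18⟩, h19⟩, h20, h21⟩
    exact ⟨h1, h2, h3, h4, h5, h6, h7, h8, h9, h10, h11, h12, h13, h14, h15, h16, h17, h18, h19,
      h20, h21⟩
  · rintro ⟨h1, h2, h3, h4, h5, h6, h7, h8, h9, h10, h11, h12, h13, h14, h15, h16, h17, h18, h19,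
      h20, h21⟩
    exact ⟨⟨⟨⟨h1, h2, h3, h4, h5, h6, h7, h8⟩, ⟨h9, h10, h11, h12, h13, h14, h15⟩, h16⟩,
      ⟨h17, h18⟩, h19⟩, h20, h21⟩

/-- `F` embeds in the models of `T[F]^*`. -/
theorem fieldEmbedding_of_theoryTStar {M : Type*} [(LangStar F).Structure M]
    (hM : M ⊨ theoryTStar F) (hS : semiringOps ⊆ semiringOps) :
    FieldEmbedding F Empty hS (starConst (F := F) M) := by
  have h := model_theoryTStar_iff.1 hM
  -- No axiom identifies `c_0` with `0` or `c_1` with `1`. It follows since `c_0` is idempotent in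
  -- the additive group and `c_1` in the group of positive elements.
  have h0 : starConst (F := F) M 0 = starZero (F := F) M := by
    obtain ⟨y, hy⟩ := h.exists_neg (starConst (F := F) M 0)
    have h1 := h.c_add 0 0
    rw [add_zero] at h1
    have h2 : starAdd (F := F) (starConst (F := F) M 0)
        (starAdd (F := F) (starConst (F := F) M 0) y) =
        starAdd (F := F) (starConst (F := F) M 0) y := by rw [← h.add_assoc, ← h1]
    rwa [hy, h.add_comm, h.zero_add] at h2
  have h1 : starConst (F := F) M 1 = starOne (F := F) M := by
    have hp := h.c_pos 1 one_pos
    obtain ⟨y, -, hy⟩ := h.exists_inv _ hp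
    have h1 := h.c_mul 1 1
    rw [mul_one] at h1
    have h2 : starMul (F := F) (starConst (F := F) M 1)
        (starMul (F := F) (starConst (F := F) M 1) y) =
        starMul (F := F) (starConst (F := F) M 1) y := by rw [← h.mul_assoc, ← h1]
    rwa [hy, h.mul_comm, h.one_mul _ hp] at h2
  have hlt : ∀ a b : F, a < b → starLT (F := F) (starConst M a) (starConst M b) := by
    intro a b hab
    have h2 := h.add_lt_add _ _ (starConst M a) (h.c_pos (b - a) (sub_pos.2 hab))
    rwa [h.zero_add, ← h.c_add, sub_add_cancel] at h2
  refine ⟨h0, h1, h.c_add, h.c_mul, fun a b => ⟨fun hab => ?_, hlt a b⟩, fun a b hab => ?_⟩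
  · rcases lt_trichotomy a b with h' | rfl | h'
    · exact h'
    · exact absurd hab (h.lt_irrefl _)
    · exact absurd (h.lt_trans _ _ _ hab (hlt b a h')) (h.lt_irrefl _)
  · rcases lt_trichotomy a b with h' | h' | h'
    · exact absurd (hab ▸ hlt a b h') (h.lt_irrefl _)
    · exact h'
    · exact absurd (hab ▸ hlt b a h') (h.lt_irrefl _)

variable (F) in
/-- The structure on the hyperreal numbers that is a model of `T[F]^*`. -/
@[reducible]
noncomputable def twistedLangStar : (LangStar F).Structure ℝ* :=
  twistedStructure F semiringOps (C := F) (A := Empty) id Empty.elim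

theorem twist_twistedOp_mul (x y : ℝ*) :
    twist F (twistedOp F .mul x y) = twist F x * twist F y :=
  (twistIso F).apply_symm_apply _

theorem twist_injective : Function.Injective (twist F) := twist_strictMono.injective

theorem twist_hyperreal_zero : twist F 0 = 0 := twist_coe (zero_mem F)

theorem twist_hyperreal_one : twist F 1 = 1 := twist_coe (one_mem F)

theorem twist_pos_iff {x : ℝ*} : 0 < twist F x ↔ 0 < x := by
  have := (twist_strictMono (F := F)).lt_iff_lt (a := 0) (b := x)
  rwa [twist_hyperreal_zero] at this

/-- The multiplicative axioms are pulled back through the injective map `twist F`. Those on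
constants hold because the twisted product with an element of `F` is the ordinary product
(`twisted_mul_coe`). -/
theorem twisted_starModel : StarModel F ℝ* 0 1 (fun a => ((a : ℝ) : ℝ*)) (· + ·)
    (twistedOp F .mul) (· < ·) (fun x k => k.rec 1 fun _ y => twistedOp F .mul y x) where
  add_assoc := add_assoc
  add_comm := add_comm
  zero_add := zero_add
  exists_neg x := ⟨-x, add_neg_cancel x⟩
  lt_irrefl := lt_irrefl
  lt_trans _ _ _ := lt_trans
  lt_trichotomy x y := or_assoc.2 (lt_trichotomy x y)
  add_lt_add x y z h := add_lt_add_left h z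
  mul_assoc x y z := twist_injective (F := F) (by simp only [twist_twistedOp_mul, mul_assoc])
  mul_comm x y := twist_injective (F := F) (by simp only [twist_twistedOp_mul, mul_comm])
  zero_lt_one := one_pos
  mul_pos x y hx hy := by
    rw [← twist_pos_iff (F := F)] at hx hy ⊢
    rw [twist_twistedOp_mul]
    exact mul_pos hx hy
  one_mul x _ := twist_injective (F := F)
    (by rw [twist_twistedOp_mul, twist_hyperreal_one, one_mul])
  exists_inv x hx := by
    obtain ⟨y, hy⟩ := twist_surjective (F := F) (twist F x)⁻¹
    have hx' := twist_pos_iff (F := F).2 hx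
    refine ⟨y, twist_pos_iff (F := F).1 (hy ▸ inv_pos.2 hx'), twist_injective (F := F) ?_⟩
    rw [twist_twistedOp_mul, hy, twist_hyperreal_one, mul_inv_cancel₀ hx'.ne']
  mul_lt_mul x y z _ hxy hz := by
    rw [← twist_strictMono.lt_iff_lt (f := twist F), twist_twistedOp_mul, twist_twistedOp_mul]
    exact mul_lt_mul_of_pos_right (twist_strictMono hxy) (twist_pos_iff.2 hz)
  exists_root k hk x hx := by
    obtain ⟨w, hw, hwk⟩ := exists_pow_eq_hyperreal hk (twist_pos_iff (F := F).2 hx)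
    obtain ⟨y, rfl⟩ := twist_surjective (F := F) w
    refine ⟨y, twist_pos_iff.1 hw, twist_injective (F := F) (Eq.trans ?_ hwk)⟩
    clear hwk hk
    induction k with
    | zero => rw [pow_zero]; exact twist_hyperreal_one
    | succ k ih => rw [pow_succ, ← ih]; exact twist_twistedOp_mul _ _
  c_add _ _ := coe_add _ _
  c_mul a b := by rw [twisted_mul_coe F a.2]; exact coe_mul _ _
  c_pos a ha := Hyperreal.coe_pos.2 ha
  add_distrib a b x := by
    rw [twisted_mul_coe F (a + b).2, twisted_mul_coe F a.2, twisted_mul_coe F b.2]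
    push_cast
    ring
  distrib_add a x y := by
    rw [twisted_mul_coe F a.2, twisted_mul_coe F a.2, twisted_mul_coe F a.2, mul_add]

variable (F) in
theorem twisted_model_theoryTStar : letI := twistedLangStar F; ℝ* ⊨ theoryTStar F := by
  let _ := twistedLangStar F
  refine model_theoryTStar_iff.2 ?_
  have hpow : (starPow (F := F) : ℝ* → ℕ → ℝ*) =
      fun x k => k.rec 1 fun _ y => twistedOp F .mul y x := by
    funext x k
    induction k with
    | zero => rfl
    | succ k ih => rw [starPow, ih]; rfl
  rw [hpow]
  exact twisted_starModel

/-- The reduction to the existential consequences of `T[F]^*`. -/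
theorem consequenceTStar_reduce_iff (F : Subfield ℝ) (hS : semiringOps ⊆ semiringOps)
    (φ : ExSentence ringOps) : ConsequenceTStar F (φ.reduce hS) ↔ InExistentialTheory F φ := by
  constructor
  · intro h
    refine exists_holds_of_twisted F (C := F) (A := Empty) id Empty.elim hS ?_
    let _ := twistedLangStar F
    have := twisted_model_theoryTStar F
    exact h.realize_sentence ℝ*
  · intro h
    obtain ⟨v, hv⟩ := (inExistentialTheory_iff F φ).1 h
    refine Theory.models_sentence_iff.2 fun M => ?_
    exact (fieldEmbedding_of_theoryTStar M.is_model hS).realize_reduce v hv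

end EmbeddingStar

end RealFragments

namespace RealFragments

/-! ### A Turing machine for the reduction -/

section Machine

open Turing

/-- The stacks of the machine. -/
inductive Stk
  | inp | out | mat | pre | nam
  deriving DecidableEq

instance : Fintype Stk := ⟨{.inp, .out, .mat, .pre, .nam}, fun x => by cases x <;> decide⟩

/-- The labels of the machine. -/
inductive Lbl
  | readPrefix | readMatrix | moveMatrix | emit (i : Fin 10) | restore (i : Fin 10) | writePrefix
  deriving Fintype

/-- The statements of the machine. The internal state holds the symbol read last. -/
abbrev MStmt : Type := TM2.Stmt (fun _ : Stk => Tok) Lbl (Option Tok)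

/-- The configurations of the machine. -/
abbrev MCfg : Type := TM2.Cfg (fun _ : Stk => Tok) Lbl (Option Tok)

/-- The tokens of the quantifier prefix. -/
def Tok.isPrefix : Tok → Bool
  | .ex => true
  | .bit _ => true
  | _ => false

/-- Push a string. -/
def pushList (k : Stk) : List Tok → MStmt → MStmt
  | [], q => q
  | a :: l, q => pushList k l (.push k (fun _ => a) q)

/-- Push the symbol read last. -/
def pushLast (k : Stk) (q : MStmt) : MStmt := .push k (fun v => v.getD .ex) q

/-- Push the reverse of the string that replaces the symbol read last. -/
def pushElimSub (k : Stk) (q : MStmt) : MStmt :=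
  .branch (fun v => decide (v = some .var)) (pushList k [.bit true, .var] q)
    (.branch (fun v => decide (v = some (.op .sub)))
      (pushList k [.var, .op .mul, .op .add, .var, .op .mul] q) (pushLast k q))

/-- Pop a symbol. -/
def popInto (k : Stk) (q : MStmt) : MStmt := .pop k (fun _ t => t) q

/-- Test whether there was no symbol to read. -/
def ifEmpty (q q' : MStmt) : MStmt := .branch (fun v => v.isNone) q q'

/-- Test whether the symbol read last is the quantifier. -/
def ifEx (q q' : MStmt) : MStmt := .branch (fun v => decide (v = some .ex)) q q'

/-- Jump to a label. -/
def jump (l : Lbl) : MStmt := .goto fun _ => l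

/-- The program. The quantifier prefix is copied to the stacks `pre` and `nam`, the transformed
matrix is written on `out`, then for each variable, from the last to the first, its conjunct is
written from right to left, and finally the new prefix. -/
def program : Lbl → MStmt
  | .readPrefix => popInto .inp (.branch (fun v => (v.map Tok.isPrefix).getD false)
      (pushLast .pre (pushLast .nam (jump .readPrefix)))
      (pushElimSub .mat (jump .readMatrix)))
  | .readMatrix => popInto .inp (ifEmpty (jump .moveMatrix)
      (pushElimSub .mat (jump .readMatrix)))
  | .moveMatrix => popInto .mat (ifEmpty (jump (.emit 9)) (pushLast .out (jump .moveMatrix)))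
  | .emit i => popInto .nam (ifEmpty (pushList .out negOneTokens (jump .writePrefix))
      (ifEx
        (pushList .out (distribChunks.getD i [] ++ [.var, .bit true])
          (pushLast .nam (jump (.restore i))))
        (pushLast .out (pushLast .inp (jump (.emit i))))))
  | .restore ⟨0, _⟩ => popInto .inp (ifEmpty (.pop .nam (fun v _ => v) (jump (.emit 9)))
      (jump (.restore 0)))
  | .restore ⟨i + 1, h⟩ => popInto .inp (ifEmpty (jump (.emit ⟨i, by omega⟩))
      (pushLast .nam (jump (.restore ⟨i + 1, h⟩))))
  | .writePrefix => popInto .pre (ifEmpty (pushList .out [.ex] .halt)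
      (ifEx (pushList .out [.ex, .bit true] (jump .writePrefix))
        (pushLast .out (jump .writePrefix))))

/-- The machine. -/
def machine : FinTM2 where
  K := Stk
  k₀ := .inp
  k₁ := .out
  Γ := fun _ => Tok
  Λ := Lbl
  main := .readPrefix
  σ := Option Tok
  initialState := none
  Γk₀Fin := inferInstanceAs (Fintype Tok)
  m := program

/-- The contents of the stacks. -/
def stks (inp out mat pre nam : List Tok) : Stk → List Tok
  | .inp => inp
  | .out => out
  | .mat => mat
  | .pre => pre
  | .nam => nam

section

variable (a b c d e x : List Tok)

@[simp]
theorem update_stks_inp : Function.update (stks a b c d e) .inp x = stks x b c d e := by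
  funext k; cases k <;> rfl

@[simp]
theorem update_stks_out : Function.update (stks a b c d e) .out x = stks a x c d e := by
  funext k; cases k <;> rfl

@[simp]
theorem update_stks_mat : Function.update (stks a b c d e) .mat x = stks a b x d e := by
  funext k; cases k <;> rfl

@[simp]
theorem update_stks_pre : Function.update (stks a b c d e) .pre x = stks a b c x e := by
  funext k; cases k <;> rfl

@[simp]
theorem update_stks_nam : Function.update (stks a b c d e) .nam x = stks a b c d x := by
  funext k; cases k <;> rfl

end

@[simp]
theorem stepAux_pushList (k : Stk) (l : List Tok) (q : MStmt) (v : Option Tok)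
    (S : Stk → List Tok) :
    TM2.stepAux (pushList k l q) v S = TM2.stepAux q v (Function.update S k (l ++ S k)) := by
  induction l generalizing q with
  | nil => simp [pushList]
  | cons a l ih => simp [pushList, ih]

@[simp]
theorem stepAux_pushLast (k : Stk) (q : MStmt) (t : Tok) (S : Stk → List Tok) :
    TM2.stepAux (pushLast k q) (some t) S =
      TM2.stepAux q (some t) (Function.update S k (t :: S k)) := rfl

@[simp]
theorem stepAux_pushElimSub (k : Stk) (q : MStmt) (t : Tok) (S : Stk → List Tok) :
    TM2.stepAux (pushElimSub k q) (some t) S =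
      TM2.stepAux q (some t) (Function.update S k (t.elimSub.reverse ++ S k)) := by
  rcases t with _ | _ | _ | _ | _ | (_ | _ | _ | _) | _ | _ | _ | _ | _ | _ <;>
    simp [pushElimSub, Tok.elimSub]

/-- The machine goes from `c` to `c'` in `n` steps. -/
def RunsIn (n : ℕ) (c c' : MCfg) : Prop :=
  (fun o : Option MCfg => o.bind (TM2.step program))^[n] (some c) = some c'

theorem RunsIn.refl (c : MCfg) : RunsIn 0 c c := rfl

theorem RunsIn.step {n : ℕ} {l : Lbl} {v : Option Tok} {S : Stk → List Tok} {c c' : MCfg}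
    (hc : TM2.stepAux (program l) v S = c) (h : RunsIn n c c') :
    RunsIn (n + 1) ⟨some l, v, S⟩ c' := by
  subst hc
  exact h

theorem RunsIn.cast {m n : ℕ} {c c' : MCfg} (h : RunsIn n c c') (hmn : m = n) : RunsIn m c c' :=
  hmn ▸ h

/-! ### The loops of the machine and their step counts -/

variable {n : ℕ} {c' : MCfg} {inp out mat pre nam : List Tok}

theorem runsIn_readPrefix {p : List Tok} (hp : ∀ t ∈ p, t.isPrefix = true)
    (h : ∀ v, RunsIn n ⟨some .readPrefix, v, stks inp out mat (p.reverse ++ pre)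
      (p.reverse ++ nam)⟩ c') (v : Option Tok) :
    RunsIn (n + p.length) ⟨some .readPrefix, v, stks (p ++ inp) out mat pre nam⟩ c' := by
  induction p generalizing v pre nam with
  | nil => exact h v
  | cons t p ih =>
    have ht : t.isPrefix = true := hp t (by simp)
    refine RunsIn.step (c := ⟨some .readPrefix, some t,
      stks (p ++ inp) out mat (t :: pre) (t :: nam)⟩) ?_
      (ih (fun t ht => hp t (by simp [ht])) (by simpa using h) _)
    simp [program, popInto, stks, ht, jump]

theorem runsIn_readPrefix_of_not {t : Tok} (ht : t.isPrefix = false)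
    (h : ∀ v, RunsIn n ⟨some .readMatrix, v, stks inp out (t.elimSub.reverse ++ mat) pre nam⟩ c')
    (v : Option Tok) :
    RunsIn (n + 1) ⟨some .readPrefix, v, stks (t :: inp) out mat pre nam⟩ c' := by
  refine RunsIn.step ?_ (h (some t))
  simp [program, popInto, stks, ht, jump]

theorem runsIn_readMatrix {s : List Tok}
    (h : ∀ v, RunsIn n ⟨some .moveMatrix, v,
      stks [] out ((s.flatMap Tok.elimSub).reverse ++ mat) pre nam⟩ c') (v : Option Tok) :
    RunsIn (n + 1 + s.length) ⟨some .readMatrix, v, stks s out mat pre nam⟩ c' := by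
  induction s generalizing v mat with
  | nil =>
    refine RunsIn.step ?_ (h none)
    simp [program, popInto, stks, jump, ifEmpty]
  | cons t s ih =>
    refine RunsIn.step (c := ⟨some .readMatrix, some t,
      stks s out (t.elimSub.reverse ++ mat) pre nam⟩) ?_ (ih (by simpa using h) _)
    simp [program, popInto, stks, jump, ifEmpty]

theorem runsIn_moveMatrix
    (h : ∀ v, RunsIn n ⟨some (.emit 9), v, stks inp (mat.reverse ++ out) [] pre nam⟩ c')
    (v : Option Tok) :
    RunsIn (n + 1 + mat.length) ⟨some .moveMatrix, v, stks inp out mat pre nam⟩ c' := by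
  induction mat generalizing v out with
  | nil =>
    refine RunsIn.step ?_ (h none)
    simp [program, popInto, stks, jump, ifEmpty]
  | cons t s ih =>
    refine RunsIn.step (c := ⟨some .moveMatrix, some t, stks inp (t :: out) s pre nam⟩) ?_
      (ih (by simpa using h) _)
    simp [program, popInto, stks, jump, ifEmpty]

/-- The stack `nam` holds the prefix reversed, so the last name is on top and ends at its `ex`.
While the name is written it is saved on `inp`, by then empty, since it is needed ten times. -/
theorem runsIn_emit {i : Fin 10} {u : List Tok} (hu : ∀ t ∈ u, t ≠ Tok.ex)
    (h : ∀ v, RunsIn n ⟨some (.restore i), v, stks (u.reverse ++ inp)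
      (distribChunks.getD i [] ++ Tok.var :: Tok.bit true :: (u.reverse ++ out)) mat pre
        (Tok.ex :: nam)⟩ c')
    (v : Option Tok) :
    RunsIn (n + 1 + u.length)
      ⟨some (.emit i), v, stks inp out mat pre (u ++ Tok.ex :: nam)⟩ c' := by
  induction u generalizing v out inp with
  | nil =>
    refine RunsIn.step ?_ (h (some .ex))
    simp [program, popInto, stks, jump, ifEmpty, ifEx]
  | cons t s ih =>
    have ht := hu t (by simp)
    refine RunsIn.step (c := ⟨some (.emit i), some t,
      stks (t :: inp) (t :: out) mat pre (s ++ Tok.ex :: nam)⟩) ?_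
      (ih (fun t ht => hu t (by simp [ht])) (by simpa using h) _)
    simp [program, popInto, stks, jump, ifEmpty, ifEx, ht]

theorem runsIn_restore {i : ℕ} {hi : i + 1 < 10}
    (h : ∀ v, RunsIn n ⟨some (.emit ⟨i, by omega⟩), v,
      stks [] out mat pre (inp.reverse ++ nam)⟩ c') (v : Option Tok) :
    RunsIn (n + 1 + inp.length)
      ⟨some (.restore ⟨i + 1, hi⟩), v, stks inp out mat pre nam⟩ c' := by
  induction inp generalizing v nam with
  | nil =>
    refine RunsIn.step ?_ (h none)
    simp [program, popInto, stks, jump, ifEmpty]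
  | cons t s ih =>
    refine RunsIn.step (c := ⟨some (.restore ⟨i + 1, hi⟩), some t,
      stks s out mat pre (t :: nam)⟩) ?_ (ih (by simpa using h) _)
    simp [program, popInto, stks, jump, ifEmpty]

/-- After the leftmost of the ten occurrences, the saved name and its `ex` on `nam` are discarded,
which exposes the preceding variable. -/
theorem runsIn_restore_zero {t : Tok}
    (h : ∀ v, RunsIn n ⟨some (.emit 9), v, stks [] out mat pre nam⟩ c') (v : Option Tok) :
    RunsIn (n + 1 + inp.length)
      ⟨some (.restore 0), v, stks inp out mat pre (t :: nam)⟩ c' := by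
  induction inp generalizing v with
  | nil =>
    refine RunsIn.step ?_ (h none)
    simp [program, popInto, stks, jump, ifEmpty]
  | cons t s ih =>
    refine RunsIn.step ?_ (ih (some t))
    simp [program, popInto, stks, jump, ifEmpty]

/-- Each round costs `u.length + 1` steps for writing the name and as many for restoring or
discarding it, counting the final read in each loop. -/
theorem runsIn_emit_chunks {i : ℕ} (hi : i < 10) {u : List Tok} (hu : ∀ t ∈ u, t ≠ Tok.ex)
    (h : ∀ v, RunsIn n ⟨some (.emit 9), v, stks []
      ((distribChunks.take (i + 1)).flatMap (fun c => c ++ Tok.var :: Tok.bit true :: u.reverse) ++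
        out) mat pre nam⟩ c') (v : Option Tok) :
    RunsIn (n + (i + 1) * (2 * u.length + 2))
      ⟨some (.emit ⟨i, hi⟩), v, stks [] out mat pre (u ++ Tok.ex :: nam)⟩ c' := by
  induction i generalizing v out with
  | zero =>
    refine (runsIn_emit hu (runsIn_restore_zero (n := n) ?_) v).cast ?_
    · simpa [distribChunks] using h
    · simp
      ring
  | succ i ih =>
    refine (runsIn_emit hu (runsIn_restore (n := n + (i + 1) * (2 * u.length + 2)) ?_) v).cast ?_
    · simp only [List.append_nil, List.reverse_reverse]
      refine ih (by omega) ?_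
      have hlen : i + 1 < distribChunks.length := hi
      rw [List.take_add_one, List.getElem?_eq_getElem hlen] at h
      simpa only [List.getD_eq_getElem?_getD, List.getElem?_eq_getElem hlen, Option.getD_some,
        Option.toList_some, List.flatMap_append, List.flatMap_cons, List.flatMap_nil,
        List.append_nil, List.append_assoc, List.cons_append] using h
    · simp
      ring

/-- The quantifier prefix as a string. -/
def prefixTokens (vars : List Var) : List Tok := vars.flatMap fun v => Tok.ex :: v.map Tok.bit

theorem runsIn_emit_all {vars : List Var}
    (h : ∀ v, RunsIn n ⟨some .writePrefix, v, stks [] (negOneTokens ++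
      (vars.flatMap (fun v => distribTokens (v.map Tok.bit)) ++ out)) mat pre []⟩ c')
    (v : Option Tok) :
    RunsIn (n + 1 + 20 * (prefixTokens vars).length)
      ⟨some (.emit 9), v, stks [] out mat pre (prefixTokens vars).reverse⟩ c' := by
  -- The output is written from right to left, so the last variable comes first. Its ten rounds cost
  -- `20 * (u.length + 1)`, and `u.length + 1` is its share of the prefix.
  induction vars using List.reverseRecOn generalizing v out with
  | nil =>
    refine RunsIn.step ?_ (h none)
    simp [program, popInto, stks, jump, ifEmpty, prefixTokens]
  | append_singleton l w ih =>
    have := runsIn_emit_chunks (i := 9) (u := (w.map Tok.bit).reverse) (out := out)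
      (n := n + 1 + 20 * (prefixTokens l).length) (mat := mat) (pre := pre)
      (nam := (prefixTokens l).reverse) (c' := c') (by omega) (by
        intro t ht
        simp only [List.mem_reverse, List.mem_map] at ht
        obtain ⟨b, -, rfl⟩ := ht
        simp) (ih (by simpa [distribTokens, distribChunks] using h)) v
    have e : (prefixTokens (l ++ [w])).reverse =
        (w.map Tok.bit).reverse ++ Tok.ex :: (prefixTokens l).reverse := by
      simp [prefixTokens]
    rw [e]
    refine this.cast ?_
    have e' := congrArg List.length e
    simp only [List.length_reverse, List.length_append, List.length_cons, List.length_map] at e' ⊢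
    rw [e']
    ring

theorem runsIn_writePrefix {vars : List Var}
    (h : RunsIn n ⟨none, none, stks [] (Tok.ex ::
      (vars.flatMap (fun v => Tok.ex :: Tok.bit true :: v.map Tok.bit) ++ out)) [] [] []⟩ c')
    (v : Option Tok) :
    RunsIn (n + 1 + (prefixTokens vars).length)
      ⟨some .writePrefix, v, stks [] out [] (prefixTokens vars).reverse []⟩ c' := by
  have bits : ∀ (w : List Bool) {n : ℕ} {c' : MCfg} {out pre : List Tok},
      (∀ v, RunsIn n ⟨some .writePrefix, v, stks [] (w.reverse.map Tok.bit ++ out) [] pre []⟩ c') →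
      ∀ v, RunsIn (n + w.length)
        ⟨some .writePrefix, v, stks [] out [] (w.map Tok.bit ++ pre) []⟩ c' := by
    intro w
    induction w with
    | nil => exact fun h => by simpa using h
    | cons b w ih =>
      intro n c' out pre h v
      refine RunsIn.step (c := ⟨some .writePrefix, some (.bit b),
        stks [] (.bit b :: out) [] (w.map Tok.bit ++ pre) []⟩) ?_ (ih (by simpa using h) _)
      simp [program, popInto, stks, jump, ifEmpty, ifEx]
  induction vars using List.reverseRecOn generalizing v out with
  | nil =>
    refine RunsIn.step ?_ h
    simp [program, popInto, stks, ifEmpty, prefixTokens]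
  | append_singleton l w ih =>
    have e : (prefixTokens (l ++ [w])).reverse =
        w.reverse.map Tok.bit ++ Tok.ex :: (prefixTokens l).reverse := by
      simp [prefixTokens]
    rw [e]
    refine (bits w.reverse (n := n + 1 + (prefixTokens l).length + 1) (fun v => ?_) v).cast ?_
    · refine RunsIn.step ?_ (ih (out := Tok.ex :: Tok.bit true :: (w.map Tok.bit ++ out))
        (by simpa using h) (some .ex))
      simp [program, popInto, stks, jump, ifEmpty, ifEx]
    · have e' := congrArg List.length e
      simp only [List.length_reverse, List.length_append, List.length_cons, List.length_map] at e' ⊢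
      omega

/-- This token tells the machine where the quantifier prefix ends. -/
theorem QF.exists_print_eq_cons {S : Set Op} {V : Type} (name : V → Var) (φ : QF S V) :
    ∃ t s, φ.print name = t :: s ∧ t.isPrefix = false := by
  cases φ <;> exact ⟨_, _, rfl, rfl⟩

theorem Tok.length_flatMap_elimSub (s : List Tok) :
    (s.flatMap Tok.elimSub).length ≤ 5 * s.length := by
  induction s with
  | nil => simp
  | cons t s ih =>
    have : t.elimSub.length ≤ 5 := by
      rcases t with _ | _ | _ | _ | _ | (_ | _ | _ | _) | _ | _ | _ | _ | _ | _ <;>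
        simp [Tok.elimSub]
    simp only [List.flatMap_cons, List.length_append, List.length_cons]
    omega

/-- The machine computes the reduction in linear time. -/
theorem exists_runsIn {S : Set Op} (hS : semiringOps ⊆ S) (φ : ExSentence ringOps) :
    ∃ n ≤ 22 * φ.print.length + 4, RunsIn n
      ⟨some .readPrefix, none, stks φ.print [] [] [] []⟩
      ⟨none, none, stks [] (φ.reduce hS).print [] [] []⟩ := by
  obtain ⟨t, s, hts, ht⟩ := φ.matrix.exists_print_eq_cons Subtype.val
  have hpre : ∀ t ∈ prefixTokens φ.vars, t.isPrefix = true := by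
    intro t ht
    simp only [prefixTokens, List.mem_flatMap, List.mem_cons, List.mem_map] at ht
    obtain ⟨v, -, rfl | ⟨b, -, rfl⟩⟩ := ht <;> rfl
  have hφ : φ.print = prefixTokens φ.vars ++ t :: s := by rw [← hts]; rfl
  have hout := φ.print_reduce hS
  rw [hts] at hout
  -- The run is assembled backwards from the halting configuration. A prefix token costs `22` steps
  -- (read, `20` for the conjuncts, write); a matrix token costs at most `6`, as its image has at
  -- most `5` tokens.
  have h1 := runsIn_writePrefix (n := 0) (vars := φ.vars) (out := negOneTokens ++
    (φ.vars.flatMap (fun v => distribTokens (v.map Tok.bit)) ++ (t :: s).flatMap Tok.elimSub))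
    (RunsIn.refl _)
  have h2 := runsIn_emit_all h1
  have h3 := runsIn_moveMatrix (out := [])
    (mat := (s.flatMap Tok.elimSub).reverse ++ (t.elimSub.reverse ++ [])) (by
      simpa only [List.append_nil, List.reverse_append, List.reverse_reverse, List.flatMap_cons]
        using h2)
  have h4 := runsIn_readMatrix (s := s) (out := []) (mat := t.elimSub.reverse ++ []) h3
  have h5 := runsIn_readPrefix (pre := []) (nam := []) hpre
    (runsIn_readPrefix_of_not ht (mat := []) (by simpa only [List.append_nil] using h4)) none
  rw [hφ, hout]
  refine ⟨_, ?_, by simpa only [List.append_nil, List.flatMap_cons, List.cons_append] using h5⟩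
  have := Tok.length_flatMap_elimSub (t :: s)
  simp only [List.length_append, List.length_reverse, List.length_cons,
    List.flatMap_cons] at this ⊢
  omega

/-- Reductions that are given by `ExSentence.reduce` are computable in linear time. -/
theorem linearTimeReducible_of_reduce {S : Set Op} (hS : semiringOps ⊆ S) {α : Type}
    {enc : α → List Tok} {P : α → Prop} {Q : ExSentence S → Prop} (e : α → ExSentence ringOps)
    (he : ∀ a, enc a = (e a).print) (hPQ : ∀ a, P a ↔ Q ((e a).reduce hS)) :
    LinearTimeReducible enc P ExSentence.print Q := by
  have key : ∀ a, Nonempty (TM2OutputsInTime machine (enc a)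
      (some ((e a).reduce hS).print) (22 * (enc a).length + 4)) := by
    intro a
    obtain ⟨n, hn, h⟩ := exists_runsIn hS (e a)
    rw [he a]
    refine ⟨⟨⟨n, ?_⟩, hn⟩⟩
    have hi : initList machine (e a).print =
        (⟨some .readPrefix, none, stks (e a).print [] [] [] []⟩ : MCfg) := by
      simp only [initList]
      congr 1
      funext k
      cases k <;> rfl
    have ho : haltList machine ((e a).reduce hS).print =
        (⟨none, none, stks [] ((e a).reduce hS).print [] [] []⟩ : MCfg) := by
      simp only [haltList]
      congr 1
      funext k
      cases k <;> rfl
    have h' : RunsIn n (initList machine (e a).print)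
      (haltList machine ((e a).reduce hS).print) := by
      rw [hi, ho]
      exact h
    exact h'
  refine ⟨fun a => (e a).reduce hS,
    { tm := machine
      inputAlphabet := Equiv.refl Tok
      outputAlphabet := Equiv.refl Tok
      time := fun n => 22 * n + 4
      outputsFun := fun a => ?_ }, ⟨22, fun n => by simp only; omega⟩, hPQ⟩
  have h := (key a).some
  have e₁ : ∀ l : List Tok, List.map (Equiv.refl Tok).invFun l = l := fun l => List.map_id l
  exact cast (congrArg₂ (fun x y => TM2OutputsInTime machine x (some y) (22 * (enc a).length + 4))
    (e₁ (enc a)) (e₁ ((e a).reduce hS).print)).symm h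

end Machine

end RealFragments

namespace RealFragments

/-! ### The reduction of strings is computable -/

section Computable

/-- The quantifier prefix, the conjuncts, the bits read last and the matrix. -/
abbrev RewriteState : Type := List Tok × List Tok × List Tok × List Tok

/-- Processing of one token, from right to left. -/
def rewriteStep (t : Tok) (s : RewriteState) : RewriteState :=
  if t = .ex then
    (.ex :: .bit true :: (s.2.2.1 ++ s.1), distribTokens s.2.2.1 ++ s.2.1, [], s.2.2.2)
  else if t.isPrefix = true then (s.1, s.2.1, t :: s.2.2.1, s.2.2.2)
  else (s.1, s.2.1, [], t.elimSub ++ (s.2.2.1 ++ s.2.2.2))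

/-- The reduction on strings. -/
def rewriteTokens (l : List Tok) : List Tok :=
  let s := l.foldr rewriteStep ([], [], [], [])
  .ex :: (s.1 ++ (negOneTokens ++ (s.2.1 ++ s.2.2.2)))

theorem primrec_rewriteTokens : Primrec rewriteTokens := by
  have hd : Primrec distribTokens := by
    refine Primrec.list_flatMap (Primrec.const _) (Primrec.list_append.comp Primrec.snd ?_)
    exact Primrec.list_cons.comp (Primrec.const _) (Primrec.list_cons.comp (Primrec.const _)
      Primrec.fst)
  have h1 : Primrec fun p : Tok × RewriteState => p.2.1 := Primrec.fst.comp Primrec.snd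
  have h2 : Primrec fun p : Tok × RewriteState => p.2.2.1 :=
    Primrec.fst.comp (Primrec.snd.comp Primrec.snd)
  have h3 : Primrec fun p : Tok × RewriteState => p.2.2.2.1 :=
    Primrec.fst.comp (Primrec.snd.comp (Primrec.snd.comp Primrec.snd))
  have h4 : Primrec fun p : Tok × RewriteState => p.2.2.2.2 :=
    Primrec.snd.comp (Primrec.snd.comp (Primrec.snd.comp Primrec.snd))
  have hs : Primrec fun p : Tok × RewriteState => rewriteStep p.1 p.2 := by
    refine Primrec.ite (Primrec.eq.comp Primrec.fst (Primrec.const _)) ?_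
      (Primrec.ite (Primrec.eq.comp ((Primrec.dom_finite _).comp Primrec.fst) (Primrec.const _))
        ?_ ?_)
    · exact Primrec.pair (Primrec.list_cons.comp (Primrec.const _)
        (Primrec.list_cons.comp (Primrec.const _) (Primrec.list_append.comp h3 h1)))
        (Primrec.pair (Primrec.list_append.comp (hd.comp h3) h2)
          (Primrec.pair (Primrec.const _) h4))
    · exact Primrec.pair h1 (Primrec.pair h2
        (Primrec.pair (Primrec.list_cons.comp Primrec.fst h3) h4))
    · exact Primrec.pair h1 (Primrec.pair h2 (Primrec.pair (Primrec.const _)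
        (Primrec.list_append.comp ((Primrec.dom_finite Tok.elimSub).comp Primrec.fst)
          (Primrec.list_append.comp h3 h4))))
  have hf : Primrec fun l : List Tok => l.foldr rewriteStep ([], [], [], []) :=
    Primrec.list_foldr Primrec.id (Primrec.const _) (hs.comp Primrec.snd).to₂
  exact Primrec.list_cons.comp (Primrec.const _) (Primrec.list_append.comp (Primrec.fst.comp hf)
    (Primrec.list_append.comp (Primrec.const _) (Primrec.list_append.comp
      (Primrec.fst.comp (Primrec.snd.comp hf))
      (Primrec.snd.comp (Primrec.snd.comp (Primrec.snd.comp hf))))))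

/-- Bits at the left end of a string stay pending, since it is not yet known whether they belong to
a quantified name or to the matrix. Thus only the concatenation of pending bits and matrix is
determined. -/
theorem foldr_rewriteStep_of_no_ex (l : List Tok) (hl : Tok.ex ∉ l) (P θ body : List Tok) :
    ∃ cur body', l.foldr rewriteStep (P, θ, [], body) = (P, θ, cur, body') ∧
      cur ++ body' = l.flatMap Tok.elimSub ++ body := by
  induction l with
  | nil => exact ⟨[], body, rfl, rfl⟩
  | cons t l ih =>
    obtain ⟨cur, body', h, h'⟩ := ih (fun h => hl (by simp [h]))
    have ht : t ≠ .ex := fun h => hl (by simp [h])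
    rw [List.foldr_cons, h, rewriteStep, if_neg ht]
    by_cases hp : t.isPrefix = true
    · rw [if_pos hp]
      refine ⟨_, _, rfl, ?_⟩
      have : t.elimSub = [t] := by
        cases t <;> simp_all [Tok.isPrefix, Tok.elimSub]
      simp [this, h']
    · rw [if_neg hp]
      refine ⟨_, _, rfl, ?_⟩
      simp [h']

theorem foldr_rewriteStep_prefix (vars : List Var) (body : List Tok) :
    (prefixTokens vars).foldr rewriteStep ([], [], [], body) =
      (vars.flatMap (fun v => Tok.ex :: Tok.bit true :: v.map Tok.bit),
        vars.flatMap (fun v => distribTokens (v.map Tok.bit)), [], body) := by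
  have bits : ∀ (w : Var) (P θ cur body : List Tok),
      (w.map Tok.bit).foldr rewriteStep (P, θ, cur, body) =
        (P, θ, w.map Tok.bit ++ cur, body) := by
    intro w P θ cur body
    induction w with
    | nil => rfl
    | cons b w ih =>
      rw [List.map_cons, List.foldr_cons, ih, rewriteStep, if_neg (by simp),
        if_pos (show (Tok.bit b).isPrefix = true from rfl)]
      rfl
  induction vars with
  | nil => rfl
  | cons w l ih =>
    have e : prefixTokens (w :: l) = Tok.ex :: (w.map Tok.bit ++ prefixTokens l) := rfl
    rw [e, List.foldr_cons, List.foldr_append, ih, bits, rewriteStep, if_pos rfl]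
    simp

theorem Tm.ex_notMem_print {S : Set Op} {V : Type} (name : V → Var) (t : Tm S V) :
    Tok.ex ∉ t.print name := by
  induction t <;> simp_all [Tm.print]

theorem QF.ex_notMem_print {S : Set Op} {V : Type} (name : V → Var) (φ : QF S V) :
    Tok.ex ∉ φ.print name := by
  induction φ <;> simp_all [QF.print, Tm.ex_notMem_print]

theorem rewriteTokens_print {S : Set Op} (hS : semiringOps ⊆ S) (φ : ExSentence ringOps) :
    rewriteTokens φ.print = (φ.reduce hS).print := by
  obtain ⟨t, s, hts, ht⟩ := φ.matrix.exists_print_eq_cons Subtype.val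
  have hex := φ.matrix.ex_notMem_print Subtype.val
  have hφ : φ.print = prefixTokens φ.vars ++ t :: s := by rw [← hts]; rfl
  rw [φ.print_reduce hS]
  rw [hts] at hex ⊢
  obtain ⟨cur, body, h, h'⟩ := foldr_rewriteStep_of_no_ex s (fun h => hex (by simp [h])) [] [] []
  have ht' : t ≠ .ex := fun h => hex (by simp [h])
  have hm : (t :: s).foldr rewriteStep ([], [], [], []) =
      ([], [], [], (t :: s).flatMap Tok.elimSub) := by
    -- The first token of the matrix is not a prefix token, so it flushes the pending bits into the
    -- matrix.
    rw [List.foldr_cons, h, rewriteStep, if_neg ht', if_neg (by simp [ht])]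
    simp [h']
  rw [rewriteTokens, hφ, List.foldr_append, hm, foldr_rewriteStep_prefix]
  rfl

/-- The reduction transfers decidability. -/
theorem DecidableProblem.of_reduce {S : Set Op} (hS : semiringOps ⊆ S) {α : Type}
    {enc : α → List Tok} {P : α → Prop} {Q : ExSentence S → Prop} (e : α → ExSentence ringOps)
    (he : ∀ a, enc a = (e a).print) (hPQ : ∀ a, P a ↔ Q ((e a).reduce hS))
    (h : DecidableProblem ExSentence.print Q) : DecidableProblem enc P := by
  obtain ⟨f, hf, hfQ⟩ := h
  refine ⟨fun l => f (rewriteTokens l), hf.comp primrec_rewriteTokens.to_comp, fun a => ?_⟩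
  change f (rewriteTokens (enc a)) = true ↔ P a
  rw [he, rewriteTokens_print hS, hfQ, hPQ]

end Computable

/-! ### Diophantine equations -/

section Diophantine

/-- A Diophantine equation as an existential sentence. -/
def DiophantineEquation.toExSentence (D : DiophantineEquation) : ExSentence ringOps :=
  ⟨D.unknowns, .eq D.lhs .zero⟩

theorem Tm.eval_eq_aeval {V : Type} (x : V → ℚ) (t : Tm ringOps V) :
    t.eval x = MvPolynomial.aeval x t.toMvPolynomial := by
  induction t with
  | var v => simp [Tm.eval, Tm.toMvPolynomial]
  | zero => simp [Tm.eval, Tm.toMvPolynomial]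
  | one => simp [Tm.eval, Tm.toMvPolynomial]
  | op o s t hs ht =>
    obtain ⟨o, ho⟩ := o
    cases o
    · simp [Tm.eval, Tm.toMvPolynomial, Op.eval, hs, ht]
    · simp [Tm.eval, Tm.toMvPolynomial, Op.eval, hs, ht]
    · simp [Tm.eval, Tm.toMvPolynomial, Op.eval, hs, ht]
    · simp [ringOps] at ho

theorem Tm.map_eval {K L : Type} [Field K] [Field L] (f : K →+* L) {S : Set Op} {V : Type}
    (v : V → K) (t : Tm S V) : f (t.eval v) = t.eval (fun x => f (v x)) := by
  induction t with
  | var x => rfl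
  | zero => exact map_zero f
  | one => exact map_one f
  | op o s t hs ht =>
    obtain ⟨o, ho⟩ := o
    cases o <;> simp [Tm.eval, Op.eval, hs, ht]

/-- Solutions are carried along the isomorphism of `ℚ` with `ratSubfield`, which commutes with the
evaluation of terms. -/
theorem DiophantineEquation.solvableInRat_iff (D : DiophantineEquation) :
    D.SolvableInRat ↔ InExistentialTheory ratSubfield D.toExSentence := by
  let f : ℚ →+* ratSubfield := (algebraMap ℚ ℝ).rangeRestrictField
  have hf : Function.Surjective f := (algebraMap ℚ ℝ).rangeRestrictField_bijective.2
  have key : ∀ x : {v // v ∈ D.unknowns} → ℚ,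
      MvPolynomial.aeval x D.lhs.toMvPolynomial = 0 ↔ D.lhs.eval (fun v => f (x v)) = 0 := by
    intro x
    rw [← Tm.eval_eq_aeval, ← Tm.map_eval, map_eq_zero_iff f f.injective]
  rw [inExistentialTheory_iff]
  constructor
  · rintro ⟨x, hx⟩
    exact ⟨fun v => f (x v), (key x).1 hx⟩
  · rintro ⟨v, hv⟩
    change {v // v ∈ D.unknowns} → ratSubfield at v
    obtain ⟨x, rfl⟩ : ∃ x : {v // v ∈ D.unknowns} → ℚ, (fun y => f (x y)) = v := by
      choose x hx using fun y => hf (v y)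
      exact ⟨x, funext hx⟩
    exact ⟨x, (key x).2 hv⟩

end Diophantine

end RealFragments

end

/-! ### The main theorem -/

theorem mainTheorem5 :
    (∀ F : Subfield ℝ,
      LinearTimeReducible ExSentence.print (InExistentialTheory F)
        ExSentence.print (ConsequenceT F) ∧
      LinearTimeReducible ExSentence.print (InExistentialTheory F)
        ExSentence.print (ConsequenceTStar F)) ∧
    (¬ DecidableProblem DiophantineEquation.print DiophantineEquation.SolvableInRat →
      ¬ DecidableProblem ExSentence.print (ConsequenceT ratSubfield) ∧
      ¬ DecidableProblem ExSentence.print (ConsequenceTStar ratSubfield)) ∧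
    LinearTimeReducible DiophantineEquation.print DiophantineEquation.SolvableInRat
      ExSentence.print (ConsequenceT ratSubfield) ∧
    LinearTimeReducible DiophantineEquation.print DiophantineEquation.SolvableInRat
      ExSentence.print (ConsequenceTStar ratSubfield) := by
  have hT := fun F φ => (consequenceT_reduce_iff F (subset_allOps semiringOps) φ).symm
  have hS := fun F φ => (consequenceTStar_reduce_iff F subset_rfl φ).symm
  have hDT := fun D : DiophantineEquation =>
    D.solvableInRat_iff.trans (hT ratSubfield D.toExSentence)
  have hDS := fun D : DiophantineEquation =>
    D.solvableInRat_iff.trans (hS ratSubfield D.toExSentence)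
  refine ⟨fun F => ⟨linearTimeReducible_of_reduce _ id (fun _ => rfl) (hT F),
    linearTimeReducible_of_reduce _ id (fun _ => rfl) (hS F)⟩, fun h => ⟨fun h' => h ?_,
    fun h' => h ?_⟩, linearTimeReducible_of_reduce _ _ (fun _ => rfl) hDT,
    linearTimeReducible_of_reduce _ _ (fun _ => rfl) hDS⟩
  · exact h'.of_reduce _ _ (fun _ => rfl) hDT
  · exact h'.of_reduce _ _ (fun _ => rfl) hDS
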